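/- **Setting.** A *marked map* is a map $g:P_0\cup U\to\mathbb C$, where $U\subset\mathbb C$ is open and $P_0=\{c_{0,1},\dots,c_{0,\nu}\}$ is a set of $\nu$ points, together with a finite set $P\supset P_0$ such that $g(P)\subset P$, $P\setminus P_0\subset U$, $g|_U$ is holomorphic and $g'(x)\neq0$ for $x\in P\setminus P_0$. It is assumed that every point of $g(P)$ lies on the forward orbit of a point of $P_0$. Put $\mathbf c_0=(c_{0,j})_j$, $c_{1,j}=g(c_{0,j})$ and $\mathbf c_1=(c_{1,j})_j$. A *local holomorphic deformation* $(g,G,\mathbf p)_W$ of $g$ consists of a connected open set $W\subset\mathbb C^\nu$ containing $\mathbf c_1$, a holomorphic map $\mathbf p=(p_1,\dots,p_\nu):W\to\mathbb C^\nu$ with $\mathbf p(\mathbf c_1)=\mathbf c_0$, and a holomorphic map $(w,z)\mapsto G_w(z)\in\mathbb C$ on $W\times U$ with $G_{\mathbf c_1}=g$ on $U$. It is *real* if $P\subset\mathbb R$, $U$ and $W$ are invariant under complex conjugation, and $g(\bar z)=\overline{g(z)}$, $G_{\bar w}(\bar z)=\overline{G_w(z)}$, $\mathbf p(\bar w)=\overline{\mathbf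 p(w)}$ for $z\in U$, $w\in W$. For each $j$: if $g^n(c_{0,j})\in P_0$ for some $n\ge1$, let $q_j$ be the least such $n$, and let $g^{q_j}(c_{0,j})=c_{0,\mu(j)}$; otherwise let $1\le l_j<q_j$ be minimal with $g^{q_j}(c_{0,j})=g^{l_j}(c_{0,j})$. For $w=(w_1,\dots,w_\nu)$ near $\mathbf c_1$ put $R_j(w)=G_w^{q_j-1}(w_j)-p_{\mu(j)}(w)$ in the first case and $R_j(w)=G_w^{q_j-1}(w_j)-G_w^{l_j-1}(w_j)$ in the second, and $\mathcal R=(R_1,\dots,R_\nu)$. A *holomorphic motion* of $g(P)$ over $(\Lambda,*)$, where $\Lambda\subset\mathbb C$ is a domain and $*\in\Lambda$, is a family of injections $h_\lambda:g(P)\to\mathbb C$, $\lambda\in\Lambda$, holomorphic in $\lambda$, with $h_*=\mathrm{id}$; it is *real* if $\Lambda$ is symmetric about $\mathbb R$, $*\in\mathbb R$, and $h_\lambda(x)\in\mathbb R$ for $\lambda\in\Lambda\cap\mathbb R$, $x\in g(P)$. Put $\mathbf c_1(\lambda)=(h_\lambda(c_{1,j}))_j$. A holomorphic motion $\hat h_\lambda$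 over a smaller neighbourhood of $*$ is a *lift* of $h_\lambda$ if, for all $\lambda$ close to $*$, $\hat h_\lambda(c_{0,j})=p_j(\mathbf c_1(\lambda))$ for every $j$ with $c_{0,j}\in g(P)$, and $G_{\mathbf c_1(\lambda)}(\hat h_\lambda(x))=h_\lambda(g(x))$ for every $x\in g(P)\setminus P_0$. The *transfer operator* $\mathcal A$ is the linear map of $\mathbb C^{g(P)}$ with $\mathcal A\big((\tfrac{d}{d\lambda}h_\lambda(x)|_{\lambda=*})_x\big)=(\tfrac{d}{d\lambda}\hat h_\lambda(x)|_{\lambda=*})_x$ whenever $\hat h_\lambda$ is a lift of $h_\lambda$. The triple has the *lifting property* if for every holomorphic motion $h^{(0)}_\lambda$ of $g(P)$ over some $(\Lambda,0)$ there are $\varepsilon>0$ with $\mathbb D_\varepsilon=\{|\lambda|<\varepsilon\}\subset\Lambda$ and holomorphic motions $h^{(k)}_\lambda$, $k\ge1$, over $(\mathbb D_\varepsilon,0)$ such that $(h^{(k)}_\lambda(c_{1,j}))_j\in W$ for all $\lambda\in\mathbb D_\varepsilon$, $k\ge0$; $h^{(k+1)}_\lambda$ is a lift of $h^{(k)}_\lambda$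 for all $k\ge0$; and $|h^{(k)}_\lambda(x)|$ is bounded uniformly in $x\in g(P)$, $k\ge0$, $\lambda\in\mathbb D_\varepsilon$. If the triple is real, it has the *real lifting property* if this holds for all real $h^{(0)}_\lambda$. **Theorem.** Suppose that the triple $(g,G,\mathbf p)_W$ has the lifting property, or that it is real and has the real lifting property. Then at least one of the following holds: 1. every eigenvalue of $\mathcal A$ lies in $\overline{\mathbb D}\setminus\{1\}$, where $\overline{\mathbb D}$ is the closed unit disk; 2. there is an open neighbourhood $W'\subset W$ of $\mathbf c_1$, contained in the domain of $\mathcal R$, such that $\{w\in W' : \mathcal R(w)=0\}$ is an analytic variety in $W'$ whose complex dimension at $\mathbf c_1$ is at least $1$. -/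

import Mathlib

open Set Filter Topology

noncomputable section

/-- A marked map `g : P₀ ∪ U → ℂ`, where `P₀ = {c₀ 0, …, c₀ (ν - 1)}` has exactly `ν` points, together
with the finite forward invariant set `P ⊇ P₀`. The map is given by a total function `ℂ → ℂ`; only its
values on `P₀ ∪ U` are ever used. -/
structure MarkedMap (ν : ℕ) where
  g : ℂ → ℂ
  U : Set ℂ
  c₀ : Fin ν → ℂ
  P : Finset ℂ
  isOpen_U : IsOpen U
  c₀_injective : Function.Injective c₀
  c₀_mem : ∀ j, c₀ j ∈ P
  mapsTo_P : ∀ x ∈ P, g x ∈ P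
  mem_U : ∀ x ∈ P, x ∉ range c₀ → x ∈ U
  differentiableOn_g : DifferentiableOn ℂ g U
  deriv_ne_zero : ∀ x ∈ P, x ∉ range c₀ → deriv g x ≠ 0

namespace MarkedMap

variable {ν : ℕ} (M : MarkedMap ν)

/-- The finite set `g(P)`. -/
def gP : Finset ℂ := M.P.image M.g

/-- The vector `𝐜₁ = (g(c_{0,1}), …, g(c_{0,ν}))`. -/
def c₁ : Fin ν → ℂ := fun j => M.g (M.c₀ j)

/-- The point `c_{1,j}`, as an element of `g(P)`. -/
def c₁' (j : Fin ν) : M.gP :=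
  ⟨M.c₁ j, Finset.mem_image_of_mem _ (M.c₀_mem j)⟩

theorem mem_P_of_mem_gP {x : ℂ} (hx : x ∈ M.gP) : x ∈ M.P := by
  obtain ⟨y, hy, rfl⟩ := Finset.mem_image.1 hx
  exact M.mapsTo_P y hy

/-- The map `g : g(P) → g(P)`. -/
def gRestr (x : M.gP) : M.gP :=
  ⟨M.g x, Finset.mem_image_of_mem _ (M.mem_P_of_mem_gP x.2)⟩

/-- Every point of `g(P)` lies on the forward orbit of a point of `P₀`. -/
def OrbitGenerated : Prop :=
  ∀ x ∈ M.gP, ∃ (j : Fin ν) (n : ℕ), M.g^[n] (M.c₀ j) = x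

/-- The marked map is real. -/
def IsReal : Prop :=
  (∀ x ∈ M.P, x.im = 0) ∧
    ∀ z ∈ M.U, starRingEnd ℂ z ∈ M.U ∧ M.g (starRingEnd ℂ z) = starRingEnd ℂ (M.g z)

/-- The orbit of `c_{0,j}` comes back to `P₀`. -/
def Returns (j : Fin ν) : Prop := ∃ n, 1 ≤ n ∧ M.g^[n] (M.c₀ j) ∈ range M.c₀

open Classical in
/-- The integer `q_j`: the first time `n ≥ 1` at which the orbit of `c_{0,j}` is in `P₀` if there is
one; otherwise the first time at which a previous point `g^l(c_{0,j})`, `l ≥ 1`, is repeated. -/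
def q (j : Fin ν) : ℕ :=
  if M.Returns j then sInf {n | 1 ≤ n ∧ M.g^[n] (M.c₀ j) ∈ range M.c₀}
  else sInf {n | ∃ l, 1 ≤ l ∧ l < n ∧ M.g^[n] (M.c₀ j) = M.g^[l] (M.c₀ j)}

/-- The integer `l_j` (used when the orbit of `c_{0,j}` does not come back to `P₀`). -/
def l (j : Fin ν) : ℕ :=
  sInf {l | 1 ≤ l ∧ M.g^[M.q j] (M.c₀ j) = M.g^[l] (M.c₀ j)}

theorem exists_index {j : Fin ν} (h : M.Returns j) :
    ∃ i, M.c₀ i = M.g^[M.q j] (M.c₀ j) := by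
  have := Nat.sInf_mem (s := {n | 1 ≤ n ∧ M.g^[n] (M.c₀ j) ∈ range M.c₀}) h
  rw [q, if_pos h]
  exact this.2

/-- The index `μ(j)` with `g^{q_j}(c_{0,j}) = c_{0,μ(j)}`. -/
def μ (j : Fin ν) (h : M.Returns j) : Fin ν := (M.exists_index h).choose

/-- `h` is a holomorphic motion of `g(P)` over `(Λ, b)`. -/
structure IsHolomorphicMotion (Λ : Set ℂ) (b : ℂ) (h : ℂ → M.gP → ℂ) : Prop where
  differentiableOn : ∀ x, DifferentiableOn ℂ (fun t => h t x) Λ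
  injective : ∀ t ∈ Λ, Function.Injective (h t)
  base : ∀ x, h b x = x

/-- The motion `h` over `Λ` is real (the base point being real). -/
def IsRealMotion (Λ : Set ℂ) (h : ℂ → M.gP → ℂ) : Prop :=
  (∀ t ∈ Λ, starRingEnd ℂ t ∈ Λ) ∧ ∀ t ∈ Λ, t.im = 0 → ∀ x, (h t x).im = 0

/-- `𝐜₁(t) = (h_t(c_{1,1}), …, h_t(c_{1,ν}))`. -/
def c₁Of (h : ℂ → M.gP → ℂ) (t : ℂ) : Fin ν → ℂ := fun j => h t (M.c₁' j)

end MarkedMap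

/-- A local holomorphic deformation `(g, G, 𝐩)_W` of the marked map `g`; `G w z` stands for `G_w(z)`
and only its values for `(w, z) ∈ W × U` are used. -/
structure LocalDeformation {ν : ℕ} (M : MarkedMap ν) where
  W : Set (Fin ν → ℂ)
  G : (Fin ν → ℂ) → ℂ → ℂ
  p : (Fin ν → ℂ) → (Fin ν → ℂ)
  isOpen_W : IsOpen W
  isConnected_W : IsConnected W
  c₁_mem : M.c₁ ∈ W
  differentiableOn_p : DifferentiableOn ℂ p W
  p_c₁ : p M.c₁ = M.c₀
  differentiableOn_G : DifferentiableOn ℂ (fun y : (Fin ν → ℂ) × ℂ => G y.1 y.2) (W ×ˢ M.U)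
  G_c₁ : ∀ z ∈ M.U, G M.c₁ z = M.g z

namespace LocalDeformation

variable {ν : ℕ} {M : MarkedMap ν} (D : LocalDeformation M)

/-- Both the marked map and its deformation are real. -/
def IsReal : Prop :=
  M.IsReal ∧
    (∀ w ∈ D.W, (fun j => starRingEnd ℂ (w j)) ∈ D.W) ∧
    (∀ w ∈ D.W, ∀ z ∈ M.U,
      D.G (fun j => starRingEnd ℂ (w j)) (starRingEnd ℂ z) = starRingEnd ℂ (D.G w z)) ∧
    ∀ w ∈ D.W, ∀ j, D.p (fun j => starRingEnd ℂ (w j)) j = starRingEnd ℂ (D.p w j)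

/-- `h'` is a lift of `h`: the two lifting equations hold for all `t` close to the base point `b`. -/
def IsLift (b : ℂ) (h h' : ℂ → M.gP → ℂ) : Prop :=
  ∀ᶠ t in 𝓝 b,
    (∀ (j : Fin ν) (hj : M.c₀ j ∈ M.gP), h' t ⟨M.c₀ j, hj⟩ = D.p (M.c₁Of h t) j) ∧
    ∀ x : M.gP, (x : ℂ) ∉ range M.c₀ → D.G (M.c₁Of h t) (h' t x) = h t (M.gRestr x)

/-- The motion `h₀` over `(Λ, 0)` admits successive lifts that are all defined on one disk around `0`
and are uniformly bounded there. -/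
def HasBoundedLifts (Λ : Set ℂ) (h₀ : ℂ → M.gP → ℂ) : Prop :=
  ∃ ε > 0, Metric.ball (0 : ℂ) ε ⊆ Λ ∧ ∃ h : ℕ → ℂ → M.gP → ℂ,
    h 0 = h₀ ∧
    (∀ k, M.IsHolomorphicMotion (Metric.ball 0 ε) 0 (h k)) ∧
    (∀ k, ∀ t ∈ Metric.ball (0 : ℂ) ε, M.c₁Of (h k) t ∈ D.W) ∧
    (∀ k, D.IsLift 0 (h k) (h (k + 1))) ∧
    ∃ C : ℝ, ∀ k, ∀ t ∈ Metric.ball (0 : ℂ) ε, ∀ x, ‖h k t x‖ ≤ C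

/-- The lifting property. -/
def LiftingProperty : Prop :=
  ∀ (Λ : Set ℂ) (h₀ : ℂ → M.gP → ℂ), IsOpen Λ → IsConnected Λ → (0 : ℂ) ∈ Λ →
    M.IsHolomorphicMotion Λ 0 h₀ → D.HasBoundedLifts Λ h₀

/-- The real lifting property: the same, for real holomorphic motions only. -/
def RealLiftingProperty : Prop :=
  ∀ (Λ : Set ℂ) (h₀ : ℂ → M.gP → ℂ), IsOpen Λ → IsConnected Λ → (0 : ℂ) ∈ Λ →
    M.IsHolomorphicMotion Λ 0 h₀ → M.IsRealMotion Λ h₀ → D.HasBoundedLifts Λ h₀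

open Classical in
/-- The transfer operator `𝒜` on `ℂ^{g(P)}`, obtained by differentiating the lifting equations at the
base point. That it sends the velocity of a motion to the velocity of its lift is `transfer_spec`. -/
def transfer : (M.gP → ℂ) →ₗ[ℂ] (M.gP → ℂ) where
  toFun v x :=
    if hx : ∃ j, M.c₀ j = x then
      fderiv ℂ D.p M.c₁ (fun k => v (M.c₁' k)) hx.choose
    else
      (v (M.gRestr x) - fderiv ℂ (fun w => D.G w x) M.c₁ (fun k => v (M.c₁' k))) / deriv M.g x
  map_add' v v' := by
    have e : (fun k => (v + v') (M.c₁' k)) = (fun k => v (M.c₁' k)) + fun k => v' (M.c₁' k) := rfl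
    ext x
    by_cases hx : ∃ j, M.c₀ j = x
    · simp only [dif_pos hx]
      rw [e, map_add, Pi.add_apply, Pi.add_apply, dif_pos hx, dif_pos hx]
    · simp only [dif_neg hx]
      rw [e, map_add, Pi.add_apply, Pi.add_apply, dif_neg hx, dif_neg hx]
      ring
  map_smul' a v := by
    have e : (fun k => (a • v) (M.c₁' k)) = a • fun k => v (M.c₁' k) := rfl
    ext x
    by_cases hx : ∃ j, M.c₀ j = x
    · simp only [dif_pos hx]
      rw [e, map_smul, Pi.smul_apply, Pi.smul_apply, dif_pos hx, RingHom.id_apply]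
    · simp only [dif_neg hx]
      rw [e, map_smul, Pi.smul_apply, Pi.smul_apply, dif_neg hx, RingHom.id_apply,
        smul_eq_mul, smul_eq_mul, smul_eq_mul]
      ring

/-- `𝒜` maps the velocity at the base point of a motion `h` to that of any lift `h'` of `h`. -/
theorem transfer_spec {Λ Λ₀ : Set ℂ} {b : ℂ} {h h' : ℂ → M.gP → ℂ}
    (hΛ : IsOpen Λ) (hb : b ∈ Λ) (hΛ₀ : IsOpen Λ₀) (hb₀ : b ∈ Λ₀)
    (hh : M.IsHolomorphicMotion Λ b h) (hh' : M.IsHolomorphicMotion Λ₀ b h')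
    (hl : D.IsLift b h h') :
    D.transfer (fun x => deriv (fun t => h t x) b) = fun x => deriv (fun t => h' t x) b := by
  have d : ∀ x, HasDerivAt (fun t => h t x) (deriv (fun t => h t x) b) b := fun x =>
    ((hh.differentiableOn x).differentiableAt (hΛ.mem_nhds hb)).hasDerivAt
  have d' : ∀ x, HasDerivAt (fun t => h' t x) (deriv (fun t => h' t x) b) b := fun x =>
    ((hh'.differentiableOn x).differentiableAt (hΛ₀.mem_nhds hb₀)).hasDerivAt
  have dc : HasDerivAt (M.c₁Of h) (fun k => deriv (fun t => h t (M.c₁' k)) b) b :=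
    hasDerivAt_pi.2 fun k => d _
  have cb : M.c₁Of h b = M.c₁ := funext fun k => hh.base _
  ext x
  by_cases hx : ∃ j, M.c₀ j = x
  · simp only [transfer, LinearMap.coe_mk, AddHom.coe_mk, dif_pos hx]
    have hp : HasFDerivAt D.p (fderiv ℂ D.p M.c₁) (M.c₁Of h b) := by
      rw [cb]
      exact (D.differentiableOn_p.differentiableAt (D.isOpen_W.mem_nhds D.c₁_mem)).hasFDerivAt
    have h1 := hasDerivAt_pi.1 (hp.comp_hasDerivAt b dc) hx.choose
    refine (h1.congr_of_eventuallyEq ?_).deriv.symm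
    filter_upwards [hl] with t ht
    have hm : M.c₀ hx.choose ∈ M.gP := by rw [hx.choose_spec]; exact x.2
    have := ht.1 hx.choose hm
    have ex : (⟨M.c₀ hx.choose, hm⟩ : M.gP) = x := Subtype.ext hx.choose_spec
    rw [ex] at this
    exact this
  · have hxP : (x : ℂ) ∈ M.P := M.mem_P_of_mem_gP x.2
    have hxU : (x : ℂ) ∈ M.U := M.mem_U x hxP hx
    simp only [transfer, LinearMap.coe_mk, AddHom.coe_mk, dif_neg hx]
    rw [div_eq_iff (M.deriv_ne_zero x hxP hx)]
    set F : (Fin ν → ℂ) × ℂ → ℂ := fun y => D.G y.1 y.2 with hF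
    have hFd : HasFDerivAt F (fderiv ℂ F (M.c₁, (x : ℂ))) (M.c₁, (x : ℂ)) :=
      (D.differentiableOn_G.differentiableAt
        ((D.isOpen_W.prod M.isOpen_U).mem_nhds ⟨D.c₁_mem, hxU⟩)).hasFDerivAt
    have hw : fderiv ℂ (fun w => D.G w x) M.c₁
        = (fderiv ℂ F (M.c₁, (x : ℂ))).comp (ContinuousLinearMap.inl ℂ _ _) := by
      refine HasFDerivAt.fderiv ?_
      exact HasFDerivAt.comp (g := F) (f := fun w => (w, (x : ℂ))) M.c₁ hFd
        (hasFDerivAt_prodMk_left M.c₁ (x : ℂ))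
    have hz : deriv M.g x = fderiv ℂ F (M.c₁, (x : ℂ)) (0, 1) := by
      have h2 : HasDerivAt (fun z => F (M.c₁, z)) (fderiv ℂ F (M.c₁, (x : ℂ)) (0, 1)) (x : ℂ) :=
        hFd.comp_hasDerivAt (x : ℂ) ((hasDerivAt_const (x : ℂ) M.c₁).prodMk (hasDerivAt_id (x : ℂ)))
      refine (h2.congr_of_eventuallyEq ?_).deriv
      filter_upwards [M.isOpen_U.mem_nhds hxU] with z hz using (D.G_c₁ z hz).symm
    have hFb : HasFDerivAt F (fderiv ℂ F (M.c₁, (x : ℂ))) (M.c₁Of h b, h' b x) := by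
      rw [cb, hh'.base]; exact hFd
    have h3 := hFb.comp_hasDerivAt b (dc.prodMk (d' x))
    have h4 : deriv (fun t => h t (M.gRestr x)) b = _ :=
      (h3.congr_of_eventuallyEq (f₁ := fun t => h t (M.gRestr x)) (by
        filter_upwards [hl] with t ht using (ht.2 x hx).symm)).deriv
    rw [h4, hw, hz]
    set L := fderiv ℂ F (M.c₁, (x : ℂ))
    have e : ((fun k => deriv (fun t => h t (M.c₁' k)) b, deriv (fun t => h' t x) b) :
          (Fin ν → ℂ) × ℂ)
        = (fun k => deriv (fun t => h t (M.c₁' k)) b, 0)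
          + deriv (fun t => h' t x) b • ((0 : Fin ν → ℂ), (1 : ℂ)) := by
      ext <;> simp
    rw [e, map_add, map_smul]
    simp

open Classical in
/-- The map `ℛ = (R_1, …, R_ν)`. -/
def R (w : Fin ν → ℂ) : Fin ν → ℂ := fun j =>
  if h : M.Returns j then (D.G w)^[M.q j - 1] (w j) - D.p w (M.μ j h)
  else (D.G w)^[M.q j - 1] (w j) - (D.G w)^[M.l j - 1] (w j)

/-- The set of the `w ∈ W` for which all the iterates that enter the definition of `ℛ(w)` make sense:
`G_w` is only ever applied to points of `U`. It is a neighbourhood of `𝐜₁`. -/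
def domR : Set (Fin ν → ℂ) :=
  {w | w ∈ D.W ∧ ∀ j, ∀ k < M.q j - 1, (D.G w)^[k] (w j) ∈ M.U}

end LocalDeformation

/-- `Z` is an analytic subvariety of the open set `Ω` of `ℂⁿ`: near each point of `Ω` it is the set of
common zeros of finitely many holomorphic functions. -/
def IsAnalyticVariety {n : ℕ} (Ω Z : Set (Fin n → ℂ)) : Prop :=
  Z ⊆ Ω ∧ ∀ a ∈ Ω, ∃ N : Set (Fin n → ℂ), IsOpen N ∧ a ∈ N ∧ N ⊆ Ω ∧
    ∃ (m : ℕ) (f : Fin m → (Fin n → ℂ) → ℂ),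
      (∀ i, DifferentiableOn ℂ (f i) N) ∧ Z ∩ N = {z | z ∈ N ∧ ∀ i, f i z = 0}

/-- `Z` contains a complex submanifold of dimension `d`, given as the image of an injective
holomorphic immersion of a nonempty open subset of `ℂᵈ`. -/
def ContainsManifold {n : ℕ} (Z : Set (Fin n → ℂ)) (d : ℕ) : Prop :=
  ∃ (V : Set (Fin d → ℂ)) (φ : (Fin d → ℂ) → (Fin n → ℂ)), IsOpen V ∧ V.Nonempty ∧
    DifferentiableOn ℂ φ V ∧ InjOn φ V ∧ (∀ v ∈ V, Function.Injective (fderiv ℂ φ v)) ∧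
    MapsTo φ V Z

/-- The analytic variety `Z` has complex dimension at least `d` at the point `a`. (The dimension of a
set is the largest dimension of a complex submanifold that it contains, and its dimension at `a` is
the smallest dimension of its intersection with a neighbourhood of `a`.) -/
def DimAtLeastAt {n : ℕ} (Z : Set (Fin n → ℂ)) (a : Fin n → ℂ) (d : ℕ) : Prop :=
  ∀ N ∈ 𝓝 a, ∃ e, d ≤ e ∧ ContainsManifold (Z ∩ N) e

end

/-! Write A for the transfer operator and ι for the inclusion of g(P) in ℂ. Lifting is encoded as an
implicit equation F(h, ĥ) = 0, where F = `liftDefect` is holomorphic near (ι, ι) and normalized so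
that its derivative there is (α, β) ↦ β − Aα. The k-th lift of a motion with velocity v has velocity
A^k v, so uniformly bounded lifts and Cauchy's estimate make A power bounded
(`exists_norm_iterate_transfer_le`). Hence its eigenvalues lie in the closed disk, and 1, if it is
an eigenvalue, is semisimple.

Suppose that Av = v ≠ 0. By semisimplicity a Lyapunov–Schmidt argument gives a holomorphic curve γ
through ι, tangent to v, along which F(γ, γ) takes values in ker(A − 1)
(`exists_curve_of_semisimple`). This curve is itself a motion, real in the real case for a real v,
and so it has bounded lifts h_k. If F(γ, γ) had a leading term t^m u with u ≠ 0, then Au = u, each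
lifting would add −t^m u to leading order, and h_k = γ − k t^m u + o(t^m) would contradict the bound
as k grows (`defect_eq_zero_of_bounded_lifts`). So γ consists of fixed points of the lifting.

At such fixed points the critical value coordinates are zeros of ℛ
(`R_eq_zero_of_liftDefect_eq_zero`). They move with nonzero speed, since a fixed vector of A that
vanishes at every c_{1,j} is zero (`eq_zero_of_critVals_eq_zero`). The zero set of ℛ therefore
contains a nonconstant holomorphic curve through 𝐜₁. -/

/-! ### Cauchy estimates -/

section Analysis

open Asymptotics

variable {E F : Type*} [NormedAddCommGroup E] [NormedSpace ℂ E]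
  [NormedAddCommGroup F] [NormedSpace ℂ F]

/-- A holomorphic function of several variables is continuously differentiable. -/
theorem contDiffOn_one_of_differentiableOn_complex [FiniteDimensional ℂ E] {f : E → F} {s : Set E}
    (hf : DifferentiableOn ℂ f s) (hs : IsOpen s) : ContDiffOn ℂ 1 f s := by
  have : ProperSpace E := FiniteDimensional.proper ℂ E
  have hc : ContinuousOn (fderiv ℂ f) s := by
    intro x hx
    refine ContinuousAt.continuousWithinAt (Metric.continuousAt_iff.2 fun η hη => ?_)
    obtain ⟨r₀, hr₀, hr₀s⟩ := Metric.isOpen_iff.1 hs x hx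
    obtain ⟨r, hr, hrr⟩ : ∃ r > 0, 2 * r < r₀ := ⟨r₀ / 3, by positivity, by linarith⟩
    have hsub : Metric.closedBall x (2 * r) ⊆ s :=
      (Metric.closedBall_subset_ball hrr).trans hr₀s
    have huc := (isCompact_closedBall x (2 * r)).uniformContinuousOn_of_continuous
      (hf.continuousOn.mono hsub)
    -- The derivatives at x and y in a direction v are compared by Cauchy's estimate on the circle
    -- |t| = r/‖v‖ for the slice t ↦ f(y + tv) − f(x + tv). Dividing η/2 · r by that radius leaves
    -- η/2 · ‖v‖.
    obtain ⟨δ, hδ, hd⟩ := Metric.uniformContinuousOn_iff.1 huc (η / 2 * r) (by positivity)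
    refine ⟨min δ r, lt_min hδ hr, fun {y} hy => ?_⟩
    have hyδ := hy.trans_le (min_le_left _ _)
    have hyr := hy.trans_le (min_le_right _ _)
    have hball : ∀ z, dist z x < r → ∀ w : E, ‖w‖ ≤ r → z + w ∈ Metric.closedBall x (2 * r) := by
      intro z hz w hw
      rw [Metric.mem_closedBall, dist_eq_norm]
      rw [dist_eq_norm] at hz
      calc ‖z + w - x‖ = ‖(z - x) + w‖ := by congr 1; abel
        _ ≤ ‖z - x‖ + ‖w‖ := norm_add_le _ _
        _ ≤ 2 * r := by linarith
    have hyx : ∀ z, dist z x < r → DifferentiableAt ℂ f z := fun z hz =>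
      hf.differentiableAt (hs.mem_nhds (hsub (by simpa using hball z hz 0 (by simpa using hr.le))))
    rw [dist_eq_norm]
    refine lt_of_le_of_lt (ContinuousLinearMap.opNorm_le_bound _ (by positivity : 0 ≤ η / 2)
      fun v => ?_) (by linarith)
    by_cases hv : v = 0
    · simp [hv]
    have hv' : 0 < ‖v‖ := norm_pos_iff.2 hv
    have hline : ∀ z, dist z x < r →
        DifferentiableOn ℂ (fun t : ℂ => f (z + t • v)) (Metric.closedBall 0 (r / ‖v‖)) := by
      intro z hz
      refine (hf.mono hsub).comp (t := Metric.closedBall x (2 * r))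
        (f := fun t : ℂ => z + t • v) (by fun_prop) ?_
      intro t ht
      refine hball z hz _ ?_
      rw [norm_smul]
      rw [mem_closedBall_zero_iff, le_div_iff₀ hv'] at ht
      exact ht
    have hder : ∀ z, dist z x < r →
        HasDerivAt (fun t : ℂ => f (z + t • v)) (fderiv ℂ f z v) 0 := by
      intro z hz
      have h1 : HasFDerivAt f (fderiv ℂ f z) (z + (0 : ℂ) • v) := by
        simpa using (hyx z hz).hasFDerivAt
      have h2 : HasDerivAt (fun t : ℂ => z + t • v) v 0 := by
        simpa using ((hasDerivAt_id (0 : ℂ)).smul_const v).const_add z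
      exact h1.comp_hasDerivAt 0 h2
    have hx0 : dist x x < r := by simpa using hr
    have key := Complex.norm_deriv_le_of_forall_mem_sphere_norm_le
      (f := fun t : ℂ => f (y + t • v) - f (x + t • v)) (c := 0) (R := r / ‖v‖)
      (C := η / 2 * r) (by positivity)
      (((hline y hyr).sub (hline x hx0)).mono
        Metric.closure_ball_subset_closedBall).diffContOnCl (by
        intro t ht
        have ht' : ‖t • v‖ ≤ r := by
          rw [norm_smul, mem_sphere_zero_iff_norm.1 ht]
          exact (div_mul_cancel₀ _ hv'.ne').le
        rw [← dist_eq_norm]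
        refine (hd _ (hball y hyr _ ht') _ (hball x hx0 _ ht') ?_).le
        simpa using hyδ)
    rw [((hder y hyr).fun_sub (hder x hx0)).deriv] at key
    calc _ ≤ _ := key
      _ = η / 2 * ‖v‖ := by field_simp
  have := (contDiffOn_succ_iff_fderiv_of_isOpen (𝕜 := ℂ) (n := 0) (f := f) hs).2
    ⟨hf, by simp, contDiffOn_zero.2 hc⟩
  simpa using this

/-- Cauchy's estimate for the leading coefficient at a zero of order `m`. -/
theorem norm_leading_coeff_le [CompleteSpace E] {f : ℂ → E} {b : E} {m : ℕ} {ε C : ℝ} (hε : 0 < ε)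
    (hf : DifferentiableOn ℂ f (Metric.ball 0 ε)) (hC : ∀ t ∈ Metric.ball (0 : ℂ) ε, ‖f t‖ ≤ C)
    (ho : (fun t => f t - t ^ m • b) =o[𝓝 0] fun t : ℂ => t ^ m) : ‖b‖ ≤ C / (ε / 2) ^ m := by
  -- The quotient f(t)/t^m has a removable singularity at 0 with value b; the maximum principle on
  -- the disk of radius ε/2 then bounds b.
  set q : ℂ → E := Function.update (fun t => (t ^ m)⁻¹ • f t) 0 b with hq
  have hcont : ContinuousAt q 0 := by
    rw [hq, continuousAt_update_same]
    have h1 := (ho.mono nhdsWithin_le_nhds (l := 𝓝[≠] 0)).tendsto_inv_smul_nhds_zero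
    have h2 := h1.add_const b
    rw [zero_add] at h2
    refine h2.congr' ?_
    filter_upwards [self_mem_nhdsWithin] with t ht
    have : t ^ m ≠ 0 := pow_ne_zero _ ht
    rw [smul_sub, inv_smul_smul₀ this, sub_add_cancel]
  have hd : DifferentiableOn ℂ q (Metric.ball 0 ε) := by
    refine (Complex.differentiableOn_compl_singleton_and_continuousAt_iff
      (Metric.ball_mem_nhds _ hε)).1 ⟨?_, hcont⟩
    refine DifferentiableOn.congr (f := fun t => (t ^ m)⁻¹ • f t) ?_ ?_
    · refine DifferentiableOn.smul ?_ (hf.mono sdiff_subset)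
      exact DifferentiableOn.inv (by fun_prop) fun t ht => pow_ne_zero _ ht.2
    · intro t ht
      exact Function.update_of_ne ht.2 _ _
  have hsub : Metric.closedBall (0 : ℂ) (ε / 2) ⊆ Metric.ball 0 ε :=
    Metric.closedBall_subset_ball (by linarith)
  have := Complex.norm_le_of_forall_mem_frontier_norm_le (f := q) (U := Metric.ball 0 (ε / 2))
    (C := C / (ε / 2) ^ m) Metric.isBounded_ball
    ((hd.mono (Metric.closure_ball_subset_closedBall.trans hsub)).diffContOnCl) (by
      intro t ht
      rw [frontier_ball _ (by positivity)] at ht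
      have htn : ‖t‖ = ε / 2 := mem_sphere_zero_iff_norm.1 ht
      have ht0 : t ≠ 0 := by rw [← norm_pos_iff, htn]; positivity
      rw [hq, Function.update_of_ne ht0, norm_smul, norm_inv, norm_pow, htn, inv_mul_eq_div]
      gcongr
      exact hC t (hsub (Metric.sphere_subset_closedBall ht)))
    (z := 0) (subset_closure (Metric.mem_ball_self (by positivity)))
  simpa [hq] using this

end Analysis

/-! ### Leading terms of successive lifts, and curves tangent to fixed vectors -/

section Analysis

open Asymptotics

variable {E : Type*} [NormedAddCommGroup E] [NormedSpace ℂ E]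

/-- If `F` has strict derivative `(α, β) ↦ β - A α`, the leading term of `b - b'` is determined by
those of `a - a'` and `F (a, b) - F (a', b')`. -/
theorem leading_term_of_strictFDeriv {F : E × E → E} {L : E × E →L[ℂ] E} {A : E →L[ℂ] E} {ι : E}
    (hF : HasStrictFDerivAt F L (ι, ι)) (hL : ∀ α β, L (α, β) = β - A α)
    {a a' b b' : ℂ → E} (ha : Tendsto a (𝓝 0) (𝓝 ι)) (ha' : Tendsto a' (𝓝 0) (𝓝 ι))
    (hb : Tendsto b (𝓝 0) (𝓝 ι)) (hb' : Tendsto b' (𝓝 0) (𝓝 ι)) {m : ℕ} {x y : E}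
    (hα : (fun t => a t - a' t - t ^ m • x) =o[𝓝 0] fun t : ℂ => t ^ m)
    (hr : (fun t => F (a t, b t) - F (a' t, b' t) - t ^ m • y) =o[𝓝 0] fun t : ℂ => t ^ m) :
    (fun t => b t - b' t - t ^ m • (A x + y)) =o[𝓝 0] fun t : ℂ => t ^ m := by
  have hsm : ∀ z : E, (fun t : ℂ => t ^ m • z) =O[𝓝 0] fun t : ℂ => t ^ m := fun z =>
    IsBigO.of_bound ‖z‖ (Eventually.of_forall fun t => by rw [norm_smul, mul_comm])
  have hαO : (fun t => a t - a' t) =O[𝓝 0] fun t : ℂ => t ^ m :=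
    (hα.isBigO.add (hsm x)).congr_left fun t => by abel
  have hrO : (fun t => F (a t, b t) - F (a' t, b' t)) =O[𝓝 0] fun t : ℂ => t ^ m :=
    (hr.isBigO.add (hsm y)).congr_left fun t => by abel
  set e : ℂ → E := fun t => A (a t - a' t) + (F (a t, b t) - F (a' t, b' t)) - (b t - b' t) with he
  set s : ℂ → E × E := fun t => (a t - a' t, b t - b' t) with hs
  have heo : e =o[𝓝 0] s := by
    have h1 : Tendsto (fun t => ((a t, b t), (a' t, b' t))) (𝓝 0) (𝓝 ((ι, ι), (ι, ι))) :=
      (ha.prodMk_nhds hb).prodMk_nhds (ha'.prodMk_nhds hb')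
    refine (hF.isLittleO.comp_tendsto h1).congr (fun t => ?_) fun t => rfl
    simp only [Function.comp, he, Prod.mk_sub_mk, hL]
    abel
  -- The linearization error e is small only relative to s, which contains b − b', of unknown size.
  -- Since s + (0, e) no longer involves b − b' and is O(t^m), the error is absorbed and s = O(t^m).
  have he2 : (fun t => ((0 : E), -e t)) =o[𝓝 0] s := by
    refine IsLittleO.of_norm_left (heo.norm_left.congr_left fun t => ?_)
    simp [Prod.norm_def]
  have hsO : s =O[𝓝 0] fun t : ℂ => t ^ m := by
    refine he2.right_isBigO_sub.trans ?_
    have h2 : (fun t => (a t - a' t, A (a t - a' t) + (F (a t, b t) - F (a' t, b' t))))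
        =O[𝓝 0] fun t : ℂ => t ^ m :=
      hαO.prod_left (((A.isBigO_comp _ _).trans hαO).add hrO)
    refine h2.congr_left fun t => ?_
    ext <;> simp [hs, he]
  have h3 := (((A.isBigO_comp _ _).trans_isLittleO hα).add hr).sub (heo.trans_isBigO hsO)
  refine h3.congr_left fun t => ?_
  simp only [he, map_sub, map_smul, smul_add]
  abel

/-- Let `γ` be a holomorphic curve along which the defect `F (γ, γ)` is fixed by `A`. If `γ` has
successive lifts that are uniformly bounded on one disk, then the defect vanishes. -/
theorem defect_eq_zero_of_bounded_lifts [CompleteSpace E]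
    {F : E × E → E} {L : E × E →L[ℂ] E} {A : E →L[ℂ] E} {ι : E}
    (hF : ContDiffAt ℂ 1 F (ι, ι)) (hFL : HasFDerivAt F L (ι, ι))
    (hL : ∀ α β, L (α, β) = β - A α) {γ : ℂ → E} (hγ : ∀ᶠ t in 𝓝 0, DifferentiableAt ℂ γ t)
    (hγA : ∀ᶠ t in 𝓝 0, A (F (γ t, γ t)) = F (γ t, γ t))
    {h : ℕ → ℂ → E} {ε C : ℝ} (hε : 0 < ε) (h0 : h 0 = γ)
    (hd : ∀ k, DifferentiableOn ℂ (h k) (Metric.ball 0 ε)) (hι : ∀ k, h k 0 = ι)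
    (hl : ∀ k, ∀ᶠ t in 𝓝 0, F (h k t, h (k + 1) t) = 0)
    (hC : ∀ k, ∀ t ∈ Metric.ball (0 : ℂ) ε, ‖h k t‖ ≤ C) :
    ∀ᶠ t in 𝓝 0, F (γ t, γ t) = 0 := by
  have hct : ∀ k, Tendsto (h k) (𝓝 0) (𝓝 ι) := fun k => by
    have := ((hd k).differentiableAt (Metric.ball_mem_nhds _ hε)).continuousAt.tendsto
    rwa [hι] at this
  have hγt : Tendsto γ (𝓝 0) (𝓝 ι) := h0 ▸ hct 0
  have hu : AnalyticAt ℂ (fun t => F (γ t, γ t)) 0 := by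
    refine Complex.analyticAt_iff_eventually_differentiableAt.2 ?_
    have h1 : ∀ᶠ z in 𝓝 (ι, ι), DifferentiableAt ℂ F z :=
      (hF.eventually (by simp)).mono fun z hz => hz.differentiableAt one_ne_zero
    filter_upwards [(hγt.prodMk_nhds hγt).eventually h1, hγ] with t ht ht'
    exact ht.comp t (ht'.prodMk ht')
  by_contra hne
  obtain ⟨m, g, hg, hg0, hgu⟩ := hu.exists_eventuallyEq_pow_smul_nonzero_iff.2 hne
  simp only [sub_zero] at hgu
  -- Divide the identity for the defect by t^m and let t tend to 0.
  have hgA : A (g 0) = g 0 := by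
    have h1 : Tendsto (fun t => A (g t)) (𝓝[≠] 0) (𝓝 (A (g 0))) :=
      ((A.continuous.continuousAt.comp hg.continuousAt).tendsto).mono_left nhdsWithin_le_nhds
    have h2 : Tendsto g (𝓝[≠] 0) (𝓝 (g 0)) := hg.continuousAt.tendsto.mono_left nhdsWithin_le_nhds
    refine tendsto_nhds_unique h1 (h2.congr' ?_)
    filter_upwards [self_mem_nhdsWithin, nhdsWithin_le_nhds hgu, nhdsWithin_le_nhds hγA]
      with t ht h3 h4
    rw [h3, map_smul] at h4
    exact (smul_right_injective E (pow_ne_zero m ht) h4).symm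
  have hgo : (fun t => F (γ t, γ t) - t ^ m • g 0) =o[𝓝 0] fun t : ℂ => t ^ m := by
    have h1 : (fun t => g t - g 0) =o[𝓝 0] fun _ : ℂ => (1 : ℂ) :=
      (isLittleO_one_iff ℂ).2 (by simpa using hg.continuousAt.tendsto.sub_const (g 0))
    have h2 := (isBigO_refl (fun t : ℂ => t ^ m) (𝓝 0)).smul_isLittleO h1
    refine h2.congr' ?_ (Eventually.of_forall fun t => by simp)
    filter_upwards [hgu] with t ht
    rw [ht, smul_sub]
  have hs : HasStrictFDerivAt F L (ι, ι) := hF.hasStrictFDerivAt' hFL one_ne_zero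
  -- For k = 0 the pair (γ, h 1) is compared with (γ, γ): the first entries agree and the values of
  -- F differ by minus the defect. Afterwards both values of F vanish, and the increment −t^m g(0)
  -- is reproduced because A fixes g(0).
  have hstep : ∀ k, (fun t => h (k + 1) t - h k t - t ^ m • (-g 0)) =o[𝓝 0] fun t : ℂ => t ^ m := by
    intro k
    induction k with
    | zero =>
      have := leading_term_of_strictFDeriv hs hL (hct 0) (hct 0) (hct 1) (hct 0)
        (m := m) (x := 0) (y := -g 0) (by simp) (by
          refine hgo.neg_left.congr' ?_ EventuallyEq.rfl
          filter_upwards [hl 0] with t ht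
          rw [ht, h0, smul_neg]
          abel)
      simpa using this
    | succ k ih =>
      have := leading_term_of_strictFDeriv hs hL (hct (k + 1)) (hct k) (hct (k + 2)) (hct (k + 1))
        (m := m) (x := -g 0) (y := 0) ih (by
          refine (isLittleO_zero _ _).congr' ?_ EventuallyEq.rfl
          filter_upwards [hl k, hl (k + 1)] with t ht ht'
          rw [ht, ht']
          simp)
      simpa [hgA] using this
  have hsum : ∀ k : ℕ, (fun t => h k t - γ t - t ^ m • (-((k : ℂ) • g 0)))
      =o[𝓝 0] fun t : ℂ => t ^ m := by
    intro k
    induction k with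
    | zero => simp [h0]
    | succ k ih =>
      refine (ih.add (hstep k)).congr_left fun t => ?_
      push_cast
      rw [add_smul, one_smul, neg_add, smul_add]
      abel
  -- The leading coefficient of h k − γ grows linearly in k, while Cauchy's estimate bounds it
  -- independently of k.
  have hbound : ∀ k : ℕ, (k : ℝ) * ‖g 0‖ ≤ (C + C) / (ε / 2) ^ m := by
    intro k
    have := norm_leading_coeff_le hε ((hd k).sub (h0 ▸ hd 0)) (C := C + C)
      (fun t ht => (norm_sub_le _ _).trans (add_le_add (hC k t ht) (by
        have := hC 0 t ht
        rwa [h0] at this))) (hsum k)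
    simpa [norm_smul] using this
  obtain ⟨k, hk⟩ := exists_nat_gt ((C + C) / (ε / 2) ^ m / ‖g 0‖)
  rw [div_lt_iff₀ (norm_pos_iff.2 hg0)] at hk
  exact absurd (hbound k) (not_le.2 hk)

/-- If `Θ` vanishes at `ι` with derivative `1 - A`, where `1` is a semisimple eigenvalue of `A`, every
eigenvector `v` is tangent to a holomorphic curve on which `Θ` is fixed by `A`; this curve has the
symmetries of `Θ`. -/
theorem exists_curve_of_semisimple [FiniteDimensional ℂ E] {Θ : E → E} {A P : E →L[ℂ] E} {ι v : E}
    (hΘ : ContDiffAt ℂ 1 Θ ι) (hΘ' : HasFDerivAt Θ (ContinuousLinearMap.id ℂ E - A) ι)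
    (hΘι : Θ ι = 0) (hAP : ∀ x, A (P x) = P x) (hPA : ∀ x, A x = x → P x = x)
    (hss : ∀ w, A (A w - w) = A w - w → A w = w) (hv : A v = v) :
    ∃ γ : ℂ → E, γ 0 = ι ∧ ContDiffAt ℂ 1 γ 0 ∧ HasDerivAt γ v 0 ∧
      (∀ᶠ t in 𝓝 0, A (Θ (γ t)) = Θ (γ t)) ∧
      ∀ σ : E →L⋆[ℂ] E, σ ι = ι → σ v = v → (∀ x, σ (P x) = P (σ x)) →
        (∀ᶠ z in 𝓝 ι, Θ (σ z) = σ (Θ z)) →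
        ∀ᶠ t in 𝓝 0, γ (starRingEnd ℂ t) = σ (γ t) := by
  have : CompleteSpace E := FiniteDimensional.complete ℂ E
  set T : E →L[ℂ] E := P + (ContinuousLinearMap.id ℂ E - A) with hT
  -- If Tx = 0, then Ax − x = Px is fixed by A, so Ax = x by semisimplicity; hence Px = 0, whereas
  -- Px = x.
  have hTinj : Function.Injective T := by
    refine (injective_iff_map_eq_zero T).2 fun x hx => ?_
    have hx' : A x - x = P x := by
      have : P x + (x - A x) = 0 := by simpa [hT] using hx
      rw [← sub_eq_zero, ← neg_eq_zero, ← this]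
      abel
    have h1 : A x = x := hss x (by rw [hx', hAP])
    rw [← hPA x h1, ← hx', h1, sub_self]
  set e : E ≃L[ℂ] E :=
    (LinearEquiv.ofInjectiveEndo (T : E →ₗ[ℂ] E) hTinj).toContinuousLinearEquiv with he
  have heT : (e : E →L[ℂ] E) = T := by
    ext x
    simp [he]
  -- The curve is γ(t) = Ψ⁻¹(tv). Along it Θ = tv − P(γ − ι) lies in the fixed space, and its
  -- velocity is T⁻¹v = v.
  set Ψ : E → E := fun z => P (z - ι) + Θ z with hΨ
  have hΨc : ContDiffAt ℂ 1 Ψ ι :=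
    (P.contDiff.contDiffAt.comp ι (contDiffAt_id.sub contDiffAt_const)).add hΘ
  have hΨd : HasFDerivAt Ψ (e : E →L[ℂ] E) ι := by
    rw [heT]
    exact (P.hasFDerivAt.comp ι ((hasFDerivAt_id ι).sub_const ι)).add hΘ'
  have hΨι : Ψ ι = 0 := by simp [hΨ, hΘι]
  have hΨs := hΨc.hasStrictFDerivAt' hΨd one_ne_zero
  set g : E → E := hΨc.localInverse hΨd one_ne_zero with hg
  have hgι : g 0 = ι := by rw [← hΨι]; exact hΨc.localInverse_apply_image hΨd one_ne_zero
  have hgc : ContDiffAt ℂ 1 g 0 := by rw [← hΨι]; exact hΨc.to_localInverse hΨd one_ne_zero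
  have hgd : HasFDerivAt g (e.symm : E →L[ℂ] E) 0 := by
    rw [← hΨι]; exact hΨs.to_localInverse.hasFDerivAt
  have hgl : ∀ᶠ x in 𝓝 ι, g (Ψ x) = x := hΨs.eventually_left_inverse
  have hgr : ∀ᶠ y in 𝓝 0, Ψ (g y) = y := by rw [← hΨι]; exact hΨs.eventually_right_inverse
  have hev : e.symm v = v := by
    rw [e.symm_apply_eq]
    have : e v = T v := by rw [← heT]; rfl
    rw [this]
    simp [hT, hv, hPA v hv]
  have htv : Tendsto (fun t : ℂ => t • v) (𝓝 0) (𝓝 0) := by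
    have : Continuous fun t : ℂ => t • v := by fun_prop
    simpa using this.tendsto 0
  have hright : ∀ᶠ t : ℂ in 𝓝 0, Ψ (g (t • v)) = t • v := htv.eventually hgr
  have hγc : ContDiffAt ℂ 1 (fun t : ℂ => g (t • v)) 0 :=
    ContDiffAt.comp (g := g) (f := fun t : ℂ => t • v) 0 (by simpa using hgc) (by fun_prop)
  refine ⟨fun t => g (t • v), by simp [hgι], hγc, ?_, ?_, ?_⟩
  · have h1 : HasDerivAt (fun t : ℂ => t • v) v 0 := by
      simpa using (hasDerivAt_id (0 : ℂ)).smul_const v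
    have h2 : HasFDerivAt g (e.symm : E →L[ℂ] E) ((0 : ℂ) • v) := by simpa using hgd
    exact (h2.comp_hasDerivAt (0 : ℂ) h1).congr_deriv hev
  · filter_upwards [hright] with t ht
    have : Θ (g (t • v)) = t • v - P (g (t • v) - ι) := by
      rw [eq_sub_iff_add_eq, add_comm]; exact ht
    rw [this, map_sub, map_smul, hv, hAP]
  -- The symmetry commutes with Ψ, hence with its local inverse, and sends tv to t̄v.
  · intro σ hσι hσv hσP hσΘ
    have hγt : Tendsto (fun t : ℂ => g (t • v)) (𝓝 0) (𝓝 ι) := by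
      simpa [hgι] using hγc.continuousAt.tendsto
    have hσt : Tendsto (fun t : ℂ => σ (g (t • v))) (𝓝 0) (𝓝 ι) := by
      have := (σ.continuous.tendsto ι).comp hγt
      rwa [hσι] at this
    filter_upwards [hright, hσt.eventually hgl, hγt.eventually hσΘ] with t h1 h2 h3
    rw [← h2]
    congr 1
    have : Ψ (σ (g (t • v))) = σ (Ψ (g (t • v))) := by
      simp only [hΨ, h3, map_add, hσP, map_sub, hσι]
    rw [this, h1, map_smulₛₗ, hσv]

end Analysis

/-! ### The lifting equations as one holomorphic equation, and their fixed points -/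

noncomputable section

namespace MarkedMap

variable {ν : ℕ} (M : MarkedMap ν)

/-- The inclusion of `g(P)` in `ℂ`, as a point of `ℂ^{g(P)}`. -/
def incl : M.gP → ℂ := fun x => x

/-- The projection `ℂ^{g(P)} → ℂ^ν` to the coordinates `c_{1,j}`. -/
def critVals : (M.gP → ℂ) →L[ℂ] (Fin ν → ℂ) :=
  ContinuousLinearMap.pi fun k => ContinuousLinearMap.proj (M.c₁' k)

@[simp]
theorem critVals_apply (z : M.gP → ℂ) (k : Fin ν) : M.critVals z k = z (M.c₁' k) := rfl

theorem critVals_incl : M.critVals M.incl = M.c₁ := rfl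

theorem iterate_succ_mem_gP (j : Fin ν) (n : ℕ) : M.g^[n + 1] (M.c₀ j) ∈ M.gP := by
  induction n with
  | zero => exact (M.c₁' j).2
  | succ n ih =>
    rw [Function.iterate_succ_apply']
    exact Finset.mem_image_of_mem _ (M.mem_P_of_mem_gP ih)

theorem iterate_notMem_range {j : Fin ν} {k : ℕ} (hk : k < M.q j - 1) :
    M.g^[k + 1] (M.c₀ j) ∉ range M.c₀ := by
  by_cases h : M.Returns j
  · intro hmem
    have : M.q j ≤ k + 1 := by
      rw [q, if_pos h]
      exact Nat.sInf_le ⟨by omega, hmem⟩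
    omega
  · exact fun hmem => h ⟨k + 1, by omega, hmem⟩

/-- A family of points close to the inclusion is injective. -/
theorem eventually_injective : ∀ᶠ z in 𝓝 M.incl, Function.Injective z := by
  have : ∀ x y : M.gP, ∀ᶠ z : M.gP → ℂ in 𝓝 M.incl, x ≠ y → z x ≠ z y := by
    intro x y
    by_cases hxy : x = y
    · simp [hxy]
    have h1 : ContinuousAt (fun z : M.gP → ℂ => z x - z y) M.incl := by fun_prop
    have h2 : M.incl x - M.incl y ≠ 0 := sub_ne_zero.2 fun h => hxy (Subtype.ext h)
    filter_upwards [h1.eventually_ne h2] with z hz _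
    exact sub_ne_zero.1 hz
  filter_upwards [eventually_all.2 fun x => eventually_all.2 fun y => this x y] with z hz x y hxy
  by_contra hne
  exact hz x y hne hxy

/-- A curve through the inclusion defines a holomorphic motion on a small disk. -/
theorem exists_isHolomorphicMotion {γ : ℂ → M.gP → ℂ} (h0 : γ 0 = M.incl)
    (hd : ∀ᶠ t in 𝓝 0, DifferentiableAt ℂ γ t) {p : ℂ → Prop} (hp : ∀ᶠ t in 𝓝 0, p t) :
    ∃ r > 0, M.IsHolomorphicMotion (Metric.ball 0 r) 0 γ ∧ ∀ t ∈ Metric.ball (0 : ℂ) r, p t := by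
  have hc : Tendsto γ (𝓝 0) (𝓝 M.incl) := h0 ▸ hd.self_of_nhds.continuousAt.tendsto
  obtain ⟨r, hr, h⟩ := Metric.eventually_nhds_iff_ball.1
    ((hd.and (hc.eventually M.eventually_injective)).and hp)
  exact ⟨r, hr, ⟨fun x t ht => (differentiableAt_pi.1 (h t ht).1.1 x).differentiableWithinAt,
    fun t ht => (h t ht).1.2, fun x => congrFun h0 x⟩, fun t ht => (h t ht).2⟩

end MarkedMap

namespace LocalDeformation

variable {ν : ℕ} {M : MarkedMap ν} (D : LocalDeformation M)

theorem contDiffAt_p : ContDiffAt ℂ 1 D.p M.c₁ :=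
  (contDiffOn_one_of_differentiableOn_complex D.differentiableOn_p D.isOpen_W).contDiffAt
    (D.isOpen_W.mem_nhds D.c₁_mem)

theorem contDiffAt_G {x : ℂ} (hx : x ∈ M.U) :
    ContDiffAt ℂ 1 (fun y : (Fin ν → ℂ) × ℂ => D.G y.1 y.2) (M.c₁, x) :=
  (contDiffOn_one_of_differentiableOn_complex D.differentiableOn_G
    (D.isOpen_W.prod M.isOpen_U)).contDiffAt
    ((D.isOpen_W.prod M.isOpen_U).mem_nhds ⟨D.c₁_mem, hx⟩)

theorem fderiv_G_left {x : ℂ} (hx : x ∈ M.U) :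
    fderiv ℂ (fun w => D.G w x) M.c₁
      = (fderiv ℂ (fun y : (Fin ν → ℂ) × ℂ => D.G y.1 y.2) (M.c₁, x)).comp
        (ContinuousLinearMap.inl ℂ _ _) :=
  (HasFDerivAt.comp (g := fun y : (Fin ν → ℂ) × ℂ => D.G y.1 y.2) (f := fun w => (w, x)) M.c₁
    ((D.contDiffAt_G hx).differentiableAt one_ne_zero).hasFDerivAt
    (hasFDerivAt_prodMk_left M.c₁ x)).fderiv

theorem deriv_g_eq {x : ℂ} (hx : x ∈ M.U) :
    deriv M.g x = fderiv ℂ (fun y : (Fin ν → ℂ) × ℂ => D.G y.1 y.2) (M.c₁, x) (0, 1) := by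
  have h2 : HasDerivAt (fun z => D.G M.c₁ z)
      (fderiv ℂ (fun y : (Fin ν → ℂ) × ℂ => D.G y.1 y.2) (M.c₁, x) (0, 1)) x :=
    ((D.contDiffAt_G hx).differentiableAt one_ne_zero).hasFDerivAt.comp_hasDerivAt x
      ((hasDerivAt_const x M.c₁).prodMk (hasDerivAt_id x))
  refine (h2.congr_of_eventuallyEq ?_).deriv
  filter_upwards [M.isOpen_U.mem_nhds hx] with z hz using (D.G_c₁ z hz).symm

open Classical in
/-- The normalized defect of the lifting equations: it vanishes at `(h_t, h'_t)` for `t` near the base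
point if `h'` is a lift of `h`. -/
def liftDefect (y : (M.gP → ℂ) × (M.gP → ℂ)) : M.gP → ℂ := fun x =>
  if hx : ∃ j, M.c₀ j = x then y.2 x - D.p (M.critVals y.1) hx.choose
  else (D.G (M.critVals y.1) (y.2 x) - y.1 (M.gRestr x)) / deriv M.g x

theorem liftDefect_of_mem (y : (M.gP → ℂ) × (M.gP → ℂ)) {x : M.gP} {j : Fin ν} (hx : M.c₀ j = x) :
    D.liftDefect y x = y.2 x - D.p (M.critVals y.1) j := by
  have h : ∃ j, M.c₀ j = x := ⟨j, hx⟩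
  have : h.choose = j := M.c₀_injective (h.choose_spec.trans hx.symm)
  rw [liftDefect, dif_pos h, this]

theorem liftDefect_of_notMem (y : (M.gP → ℂ) × (M.gP → ℂ)) {x : M.gP} (hx : (x : ℂ) ∉ range M.c₀) :
    D.liftDefect y x
      = (D.G (M.critVals y.1) (y.2 x) - y.1 (M.gRestr x)) / deriv M.g x := by
  have h : ¬∃ j, M.c₀ j = x := hx
  rw [liftDefect, dif_neg h]

theorem transfer_of_mem (v : M.gP → ℂ) {x : M.gP} {j : Fin ν} (hx : M.c₀ j = x) :
    D.transfer v x = fderiv ℂ D.p M.c₁ (M.critVals v) j := by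
  have h : ∃ j, M.c₀ j = x := ⟨j, hx⟩
  have : h.choose = j := M.c₀_injective (h.choose_spec.trans hx.symm)
  simp only [transfer, LinearMap.coe_mk, AddHom.coe_mk, dif_pos h, this]
  rfl

theorem transfer_of_notMem (v : M.gP → ℂ) {x : M.gP} (hx : (x : ℂ) ∉ range M.c₀) :
    D.transfer v x
      = (v (M.gRestr x) - fderiv ℂ (fun w => D.G w x) M.c₁ (M.critVals v)) / deriv M.g x := by
  have h : ¬∃ j, M.c₀ j = x := hx
  simp only [transfer, LinearMap.coe_mk, AddHom.coe_mk, dif_neg h]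
  rfl

theorem mem_U_of_notMem {x : M.gP} (hx : (x : ℂ) ∉ range M.c₀) : (x : ℂ) ∈ M.U :=
  M.mem_U x (M.mem_P_of_mem_gP x.2) hx

theorem deriv_ne_zero_of_notMem {x : M.gP} (hx : (x : ℂ) ∉ range M.c₀) : deriv M.g x ≠ 0 :=
  M.deriv_ne_zero x (M.mem_P_of_mem_gP x.2) hx

theorem contDiffAt_liftDefect : ContDiffAt ℂ 1 D.liftDefect (M.incl, M.incl) := by
  refine contDiffAt_pi.2 fun x => ?_
  have hc : ContDiffAt ℂ 1 (fun y : (M.gP → ℂ) × (M.gP → ℂ) => M.critVals y.1) (M.incl, M.incl) :=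
    (M.critVals.contDiff.comp contDiff_fst).contDiffAt
  by_cases hx : (x : ℂ) ∈ range M.c₀
  · obtain ⟨j, hj⟩ := hx
    simp only [D.liftDefect_of_mem _ hj]
    have h1 : ContDiffAt ℂ 1 (fun y : (M.gP → ℂ) × (M.gP → ℂ) => D.p (M.critVals y.1))
        (M.incl, M.incl) := ContDiffAt.comp (g := D.p) (M.incl, M.incl) D.contDiffAt_p hc
    exact ContDiffAt.sub (by fun_prop) (contDiffAt_pi.1 h1 j)
  · simp only [D.liftDefect_of_notMem _ hx]
    have h1 : ContDiffAt ℂ 1 (fun y : (M.gP → ℂ) × (M.gP → ℂ) => D.G (M.critVals y.1) (y.2 x))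
        (M.incl, M.incl) :=
      ContDiffAt.comp (g := fun y : (Fin ν → ℂ) × ℂ => D.G y.1 y.2)
        (f := fun y : (M.gP → ℂ) × (M.gP → ℂ) => (M.critVals y.1, y.2 x)) (M.incl, M.incl)
        (D.contDiffAt_G (mem_U_of_notMem hx)) (hc.prodMk (by fun_prop))
    exact (h1.sub (by fun_prop)).div_const _

/-- The transfer operator as a continuous linear map. -/
def transferCLM : (M.gP → ℂ) →L[ℂ] (M.gP → ℂ) := LinearMap.toContinuousLinearMap D.transfer

@[simp]
theorem transferCLM_apply (v : M.gP → ℂ) : D.transferCLM v = D.transfer v := rfl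

/-- Division by g'(x) makes the partial derivative in the lift the identity. This puts the equation
in the form to which the lemmas on leading terms apply. -/
theorem hasFDerivAt_liftDefect :
    HasFDerivAt D.liftDefect (ContinuousLinearMap.snd ℂ (M.gP → ℂ) (M.gP → ℂ)
      - D.transferCLM.comp (ContinuousLinearMap.fst ℂ _ _)) (M.incl, M.incl) := by
  refine hasFDerivAt_pi'.2 fun x => ?_
  have hc : HasFDerivAt (fun y : (M.gP → ℂ) × (M.gP → ℂ) => M.critVals y.1)
      (M.critVals.comp (ContinuousLinearMap.fst ℂ _ _)) (M.incl, M.incl) :=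
    M.critVals.hasFDerivAt.comp _ hasFDerivAt_fst
  have hp2 : HasFDerivAt (fun y : (M.gP → ℂ) × (M.gP → ℂ) => y.2 x)
      ((ContinuousLinearMap.proj x).comp (ContinuousLinearMap.snd ℂ _ _)) (M.incl, M.incl) :=
    ((ContinuousLinearMap.proj (R := ℂ) (φ := fun _ : M.gP => ℂ) x).comp
      (ContinuousLinearMap.snd ℂ (M.gP → ℂ) (M.gP → ℂ))).hasFDerivAt
  by_cases hx : (x : ℂ) ∈ range M.c₀
  · obtain ⟨j, hj⟩ := hx
    simp only [D.liftDefect_of_mem _ hj]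
    have hp : HasFDerivAt D.p (fderiv ℂ D.p M.c₁) (M.critVals M.incl) :=
      (D.contDiffAt_p.differentiableAt one_ne_zero).hasFDerivAt
    have h1 := hasFDerivAt_pi'.1 (HasFDerivAt.comp (M.incl, M.incl) hp hc) j
    refine (hp2.fun_sub h1).congr_fderiv ?_
    ext y <;> simp [D.transfer_of_mem _ hj]
  · simp only [D.liftDefect_of_notMem _ hx]
    have hxU := mem_U_of_notMem hx
    have hG : HasFDerivAt (fun y : (Fin ν → ℂ) × ℂ => D.G y.1 y.2)
        (fderiv ℂ (fun y : (Fin ν → ℂ) × ℂ => D.G y.1 y.2) (M.c₁, (x : ℂ)))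
        (M.critVals M.incl, M.incl x) :=
      ((D.contDiffAt_G hxU).differentiableAt one_ne_zero).hasFDerivAt
    have h1 := HasFDerivAt.comp (f := fun y : (M.gP → ℂ) × (M.gP → ℂ) => (M.critVals y.1, y.2 x))
      (M.incl, M.incl) hG (hc.prodMk hp2)
    have hp1 : HasFDerivAt (fun y : (M.gP → ℂ) × (M.gP → ℂ) => y.1 (M.gRestr x))
        ((ContinuousLinearMap.proj (M.gRestr x)).comp (ContinuousLinearMap.fst ℂ _ _))
        (M.incl, M.incl) :=
      ((ContinuousLinearMap.proj (R := ℂ) (φ := fun _ : M.gP => ℂ) (M.gRestr x)).comp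
        (ContinuousLinearMap.fst ℂ (M.gP → ℂ) (M.gP → ℂ))).hasFDerivAt
    have h2 := (h1.fun_sub hp1).mul_const (deriv M.g x)⁻¹
    simp only [div_eq_mul_inv]
    refine h2.congr_fderiv ?_
    have hne := deriv_ne_zero_of_notMem hx
    refine ContinuousLinearMap.ext fun y => ?_
    have hz := D.deriv_g_eq hxU
    have hw := congrArg (fun T => T (M.critVals y.1)) (D.fderiv_G_left hxU)
    set T := fderiv ℂ (fun y : (Fin ν → ℂ) × ℂ => D.G y.1 y.2) (M.c₁, (x : ℂ))
    have e : ((M.critVals y.1, y.2 x) : (Fin ν → ℂ) × ℂ)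
        = (M.critVals y.1, 0) + y.2 x • ((0 : Fin ν → ℂ), (1 : ℂ)) := by
      ext <;> simp
    have hTy : T (M.critVals y.1, y.2 x)
        = fderiv ℂ (fun w => D.G w x) M.c₁ (M.critVals y.1) + y.2 x * deriv M.g x := by
      rw [e, map_add, map_smul, ← hz, smul_eq_mul, hw]
      rfl
    change (deriv M.g x)⁻¹ * (T (M.critVals y.1, y.2 x) - y.1 (M.gRestr x))
      = y.2 x - D.transfer y.1 x
    rw [hTy, D.transfer_of_notMem _ hx]
    field_simp
    ring

theorem liftDefect_incl : D.liftDefect (M.incl, M.incl) = 0 := by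
  ext x
  by_cases hx : (x : ℂ) ∈ range M.c₀
  · obtain ⟨j, hj⟩ := hx
    rw [D.liftDefect_of_mem _ hj, M.critVals_incl, D.p_c₁, hj]
    simp [MarkedMap.incl]
  · rw [D.liftDefect_of_notMem _ hx, M.critVals_incl]
    simp [MarkedMap.incl, D.G_c₁ x (mem_U_of_notMem hx), MarkedMap.gRestr]

variable {D}

theorem IsLift.eventually_liftDefect_eq_zero {b : ℂ} {h h' : ℂ → M.gP → ℂ} (hl : D.IsLift b h h') :
    ∀ᶠ t in 𝓝 b, D.liftDefect (h t, h' t) = 0 := by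
  filter_upwards [hl] with t ht
  have e : M.critVals (h t) = M.c₁Of h t := rfl
  ext x
  by_cases hx : (x : ℂ) ∈ range M.c₀
  · obtain ⟨j, hj⟩ := hx
    have hm : M.c₀ j ∈ M.gP := hj ▸ x.2
    have ex : (⟨M.c₀ j, hm⟩ : M.gP) = x := Subtype.ext hj
    have := ht.1 j hm
    rw [ex] at this
    rw [D.liftDefect_of_mem _ hj, e]
    exact sub_eq_zero.2 this
  · rw [D.liftDefect_of_notMem _ hx, e, ht.2 x hx]
    simp

/-- Along an orbit that avoids `P₀`, a fixed point of the lifting is transported by `G_w`. -/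
theorem iterate_G_of_liftDefect_eq_zero {z : M.gP → ℂ} (hz : D.liftDefect (z, z) = 0) (j : Fin ν)
    {n : ℕ} (hn : ∀ k < n, M.g^[k + 1] (M.c₀ j) ∉ range M.c₀) :
    (D.G (M.critVals z))^[n] (M.critVals z j)
      = z ⟨M.g^[n + 1] (M.c₀ j), M.iterate_succ_mem_gP j n⟩ := by
  induction n with
  | zero => rfl
  | succ n ih =>
    rw [Function.iterate_succ_apply', ih fun k hk => hn k (by omega)]
    have h1 := congrFun hz ⟨M.g^[n + 1] (M.c₀ j), M.iterate_succ_mem_gP j n⟩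
    have hx := hn n (by omega)
    rw [D.liftDefect_of_notMem _ hx, Pi.zero_apply, div_eq_zero_iff,
      or_iff_left (deriv_ne_zero_of_notMem (x := ⟨_, M.iterate_succ_mem_gP j n⟩) hx),
      sub_eq_zero] at h1
    refine h1.trans (congrArg z (Subtype.ext ?_))
    exact (Function.iterate_succ_apply' M.g (n + 1) (M.c₀ j)).symm

/-- `ℛ` vanishes at the fixed points of the lifting. -/
theorem R_eq_zero_of_liftDefect_eq_zero {z : M.gP → ℂ} (hz : D.liftDefect (z, z) = 0) :
    D.R (M.critVals z) = 0 := by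
  ext j
  by_cases h : M.Returns j
  · have hq : 1 ≤ M.q j := by
      have := Nat.sInf_mem (s := {n | 1 ≤ n ∧ M.g^[n] (M.c₀ j) ∈ range M.c₀}) h
      rw [MarkedMap.q, if_pos h]
      exact this.1
    have hμ : M.c₀ (M.μ j h) = M.g^[M.q j - 1 + 1] (M.c₀ j) := by
      rw [Nat.sub_add_cancel hq]
      exact (M.exists_index h).choose_spec
    rw [R, dif_pos h, iterate_G_of_liftDefect_eq_zero hz j
      (fun k hk => M.iterate_notMem_range hk)]
    have h1 := congrFun hz ⟨M.g^[M.q j - 1 + 1] (M.c₀ j), M.iterate_succ_mem_gP j _⟩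
    rwa [D.liftDefect_of_mem _ hμ] at h1
  · have hn : ∀ n, ∀ k < n, M.g^[k + 1] (M.c₀ j) ∉ range M.c₀ := fun n k _ hm =>
      h ⟨k + 1, by omega, hm⟩
    rw [R, dif_neg h, iterate_G_of_liftDefect_eq_zero hz j (hn _),
      iterate_G_of_liftDefect_eq_zero hz j (hn _), Pi.zero_apply, sub_eq_zero]
    congr 2
    -- The two exponents are q − 1 + 1 and l − 1 + 1 with truncated subtraction. If the set defining
    -- l is empty, then l = 0, and also q = 0 since otherwise q would belong to it; both exponents
    -- are then 1.
    rcases Set.eq_empty_or_nonempty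
      {l | 1 ≤ l ∧ M.g^[M.q j] (M.c₀ j) = M.g^[l] (M.c₀ j)} with he | hne
    · have hl : M.l j = 0 := by rw [MarkedMap.l, he, Nat.sInf_empty]
      have hq : M.q j = 0 := by
        by_contra hq
        exact he.subset ⟨Nat.one_le_iff_ne_zero.2 hq, rfl⟩
      rw [hl, hq]
    · obtain ⟨hl1, hl2⟩ : 1 ≤ M.l j ∧ M.g^[M.q j] (M.c₀ j) = M.g^[M.l j] (M.c₀ j) :=
        Nat.sInf_mem hne
      -- The orbit stays in the finite set g(P), so a repetition exists and the infimum defining q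
      -- is attained at a value larger than some l ≥ 1.
      have hq : 1 ≤ M.q j := by
        by_contra hq
        obtain ⟨n, hn⟩ : {n | ∃ l, 1 ≤ l ∧ l < n ∧
            M.g^[n] (M.c₀ j) = M.g^[l] (M.c₀ j)}.Nonempty := by
          obtain ⟨a, b, hab, hlt⟩ : ∃ a b : ℕ, a < b ∧
              M.g^[a + 1] (M.c₀ j) = M.g^[b + 1] (M.c₀ j) := by
            obtain ⟨a, b, hne, heq⟩ := Finite.exists_ne_map_eq_of_infinite
              fun n : ℕ => (⟨_, M.iterate_succ_mem_gP j n⟩ : M.gP)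
            rcases hne.lt_or_gt with hlt | hlt
            · exact ⟨a, b, hlt, congrArg Subtype.val heq⟩
            · exact ⟨b, a, hlt, (congrArg Subtype.val heq).symm⟩
          exact ⟨b + 1, a + 1, by omega, by omega, hlt.symm⟩
        have hmem := Nat.sInf_mem (⟨n, hn⟩ : {n | ∃ l, 1 ≤ l ∧ l < n ∧
            M.g^[n] (M.c₀ j) = M.g^[l] (M.c₀ j)}.Nonempty)
        have hq' : M.q j = sInf {n | ∃ l, 1 ≤ l ∧ l < n ∧
            M.g^[n] (M.c₀ j) = M.g^[l] (M.c₀ j)} := by rw [MarkedMap.q, if_neg h]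
        rw [← hq'] at hmem
        obtain ⟨l, h1, h2, -⟩ := hmem
        omega
      rw [Nat.sub_add_cancel hq, Nat.sub_add_cancel hl1, hl2]

end LocalDeformation
end

/-! ### Real structure -/

noncomputable section

/-- A projection to the fixed space of an endomorphism of a finite-dimensional space. -/
theorem exists_projection_fixed {E : Type*} [NormedAddCommGroup E] [NormedSpace ℂ E]
    [FiniteDimensional ℂ E] (A : E →L[ℂ] E) :
    ∃ P : E →L[ℂ] E, (∀ x, A (P x) = P x) ∧ ∀ x, A x = x → P x = x := by
  set K : Submodule ℂ E := LinearMap.ker ((A : E →ₗ[ℂ] E) - LinearMap.id) with hK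
  have hKm : ∀ x, x ∈ K ↔ A x = x := fun x => by simp [hK, sub_eq_zero]
  obtain ⟨P, hP⟩ := LinearMap.exists_leftInverse_of_injective K.subtype (K.ker_subtype)
  refine ⟨LinearMap.toContinuousLinearMap (K.subtype ∘ₗ P), fun x => (hKm _).1 (P x).2,
    fun x hx => ?_⟩
  have := LinearMap.congr_fun hP ⟨x, (hKm x).2 hx⟩
  exact congrArg Subtype.val this

/-- The projection to the fixed space can be chosen compatible with a real structure. -/
theorem exists_projection_fixed_conj {E : Type*} [NormedAddCommGroup E] [NormedSpace ℂ E]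
    [FiniteDimensional ℂ E] (A : E →L[ℂ] E) (σ : E →L⋆[ℂ] E) (hσ : ∀ x, σ (σ x) = x)
    (hA : ∀ x, σ (A x) = A (σ x)) :
    ∃ P : E →L[ℂ] E, (∀ x, A (P x) = P x) ∧ (∀ x, A x = x → P x = x) ∧
      ∀ x, σ (P x) = P (σ x) := by
  obtain ⟨P, h1, h2⟩ := exists_projection_fixed A
  -- Averaging over σ keeps a projection to the fixed space, because σ preserves that space.
  refine ⟨(2⁻¹ : ℂ) • (P + σ.comp (P.comp σ)), fun x => ?_, fun x hx => ?_, fun x => ?_⟩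
  · simp [← hA, h1]
  · have : P (σ x) = σ x := h2 _ (by rw [← hA, hx])
    simp only [smul_apply, add_apply,
      ContinuousLinearMap.comp_apply, h2 x hx, this, hσ, ← two_smul ℂ x]
    exact inv_smul_smul₀ two_ne_zero x
  · simp [map_smulₛₗ, hσ, add_comm, map_ofNat]

namespace MarkedMap

variable {ν : ℕ} (M : MarkedMap ν)

/-- Complex conjugation on `ℂ^{g(P)}`. -/
def conjCLM : (M.gP → ℂ) →L⋆[ℂ] (M.gP → ℂ) :=
  ((starL ℂ : (M.gP → ℂ) ≃L⋆[ℂ] (M.gP → ℂ)) : (M.gP → ℂ) →L⋆[ℂ] (M.gP → ℂ))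

@[simp]
theorem conjCLM_apply (z : M.gP → ℂ) : M.conjCLM z = star z := rfl

end MarkedMap

namespace LocalDeformation

variable {ν : ℕ} {M : MarkedMap ν} {D : LocalDeformation M}

theorem IsReal.star_incl (hR : D.IsReal) : star M.incl = M.incl := by
  ext x
  exact Complex.conj_eq_iff_im.2 (hR.1.1 x (M.mem_P_of_mem_gP x.2))

theorem IsReal.conj_deriv_g (hR : D.IsReal) {x : M.gP} (hx : (x : ℂ) ∉ range M.c₀) :
    starRingEnd ℂ (deriv M.g x) = deriv M.g x := by
  have hxr : starRingEnd ℂ (x : ℂ) = x := congrFun hR.star_incl x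
  have hxU := mem_U_of_notMem hx
  have h1 : HasDerivAt M.g (deriv M.g x) x :=
    (M.differentiableOn_g.differentiableAt (M.isOpen_U.mem_nhds hxU)).hasDerivAt
  have h2 := h1.conj_conj
  rw [hxr] at h2
  refine (h2.congr_of_eventuallyEq (f₁ := M.g) ?_).deriv.symm
  filter_upwards [M.isOpen_U.mem_nhds hxU] with z hz
  simp [(hR.1.2 z hz).2]

theorem IsReal.eventually_liftDefect_star (hR : D.IsReal) :
    ∀ᶠ y : (M.gP → ℂ) × (M.gP → ℂ) in 𝓝 (M.incl, M.incl),
      D.liftDefect (star y.1, star y.2) = star (D.liftDefect y) := by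
  have hW : ∀ᶠ y : (M.gP → ℂ) × (M.gP → ℂ) in 𝓝 (M.incl, M.incl), M.critVals y.1 ∈ D.W := by
    have : ContinuousAt (fun y : (M.gP → ℂ) × (M.gP → ℂ) => M.critVals y.1) (M.incl, M.incl) := by
      fun_prop
    exact this (D.isOpen_W.mem_nhds D.c₁_mem)
  have hU : ∀ᶠ y : (M.gP → ℂ) × (M.gP → ℂ) in 𝓝 (M.incl, M.incl),
      ∀ x : M.gP, (x : ℂ) ∉ range M.c₀ → y.2 x ∈ M.U := by
    refine eventually_all.2 fun x => ?_
    by_cases hx : (x : ℂ) ∈ range M.c₀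
    · exact Eventually.of_forall fun y h => absurd hx h
    · have : ContinuousAt (fun y : (M.gP → ℂ) × (M.gP → ℂ) => y.2 x) (M.incl, M.incl) := by
        fun_prop
      filter_upwards [this (M.isOpen_U.mem_nhds (mem_U_of_notMem hx))] with y hy _ using hy
  filter_upwards [hW, hU] with y hyW hyU
  have e : M.critVals (star y.1) = fun j => starRingEnd ℂ (M.critVals y.1 j) := rfl
  ext x
  rw [Pi.star_apply]
  by_cases hx : (x : ℂ) ∈ range M.c₀
  · obtain ⟨j, hj⟩ := hx
    rw [D.liftDefect_of_mem _ hj, D.liftDefect_of_mem _ hj, e, hR.2.2.2 _ hyW j, star_sub]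
    rfl
  · rw [D.liftDefect_of_notMem _ hx, D.liftDefect_of_notMem _ hx, e]
    change (D.G _ (starRingEnd ℂ (y.2 x)) - starRingEnd ℂ (y.1 (M.gRestr x))) / deriv M.g x
      = starRingEnd ℂ (_ / _)
    rw [hR.2.2.1 _ hyW _ (hyU x hx), map_div₀, hR.conj_deriv_g hx, map_sub]

/-- Differentiate the conjugation symmetry of the defect and use uniqueness of the derivative.
Conjugation is only real linear, so derivatives are taken over ℝ. -/
theorem IsReal.transfer_star (hR : D.IsReal) (v : M.gP → ℂ) :
    D.transfer (star v) = star (D.transfer v) := by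
  set s : (M.gP → ℂ) →L[ℝ] (M.gP → ℂ) :=
    ((starL' ℝ : (M.gP → ℂ) ≃L[ℝ] (M.gP → ℂ)) : (M.gP → ℂ) →L[ℝ] (M.gP → ℂ)) with hs
  have hsa : ∀ z, s z = star z := fun z => rfl
  have h1 := D.hasFDerivAt_liftDefect.restrictScalars ℝ
  have h2 : HasFDerivAt (fun y : (M.gP → ℂ) × (M.gP → ℂ) => (s y.1, s y.2)) (s.prodMap s)
      (M.incl, M.incl) := (s.prodMap s).hasFDerivAt
  have h3 : (s.prodMap s) (M.incl, M.incl) = (M.incl, M.incl) := by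
    simp [hsa, hR.star_incl]
  have h4 := HasFDerivAt.comp (M.incl, M.incl) (g := D.liftDefect)
    (f := fun y : (M.gP → ℂ) × (M.gP → ℂ) => (s y.1, s y.2)) (by
      have h5 : (s M.incl, s M.incl) = (M.incl, M.incl) := h3
      simp only [h5]
      exact h1) h2
  have h6 := s.hasFDerivAt.comp (M.incl, M.incl) h1
  have h7 := h4.unique (h6.congr_of_eventuallyEq hR.eventually_liftDefect_star)
  have h8 := congrArg (fun T => T (v, 0)) h7
  have h9 : (0 : M.gP → ℂ) - D.transfer (star v) = star (0 - D.transfer v) := by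
    simpa [hsa] using h8
  simpa using h9

/-! ### Spectral consequences of the lifting property -/

/-- Curves through the inclusion, real if the deformation is real, have bounded lifts. -/
theorem exists_hasBoundedLifts (hD : D.LiftingProperty ∨ (D.IsReal ∧ D.RealLiftingProperty))
    {γ : ℂ → M.gP → ℂ} (h0 : γ 0 = M.incl) (hd : ∀ᶠ t in 𝓝 0, DifferentiableAt ℂ γ t)
    (hreal : D.IsReal → ∀ᶠ t in 𝓝 0, γ (starRingEnd ℂ t) = star (γ t)) :
    ∃ Λ, D.HasBoundedLifts Λ γ := by
  have hconn : ∀ r > 0, IsConnected (Metric.ball (0 : ℂ) r) := fun r hr =>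
    ⟨⟨0, Metric.mem_ball_self hr⟩, (convex_ball 0 r).isPreconnected⟩
  rcases hD with hD | ⟨hR, hD⟩
  · obtain ⟨r, hr, hm, -⟩ := M.exists_isHolomorphicMotion h0 hd (p := fun _ => True) (by simp)
    exact ⟨_, hD _ γ Metric.isOpen_ball (hconn r hr) (Metric.mem_ball_self hr) hm⟩
  · obtain ⟨r, hr, hm, hp⟩ := M.exists_isHolomorphicMotion h0 hd (hreal hR)
    refine ⟨_, hD _ γ Metric.isOpen_ball (hconn r hr) (Metric.mem_ball_self hr) hm ⟨?_, ?_⟩⟩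
    · intro t ht
      simpa using ht
    · intro t ht him x
      have h1 := congrFun (hp t ht) x
      rw [Complex.conj_eq_iff_im.2 him] at h1
      exact Complex.conj_eq_iff_im.1 h1.symm

/-- The iterates of `𝒜` are bounded on the velocity of a motion with bounded lifts. -/
theorem HasBoundedLifts.exists_norm_iterate_transfer_le {Λ : Set ℂ} {γ : ℂ → M.gP → ℂ}
    {v : M.gP → ℂ} (h : D.HasBoundedLifts Λ γ) (hv : HasDerivAt γ v 0) :
    ∃ C, ∀ k : ℕ, ‖D.transfer^[k] v‖ ≤ C := by
  obtain ⟨ε, hε, -, h, h0, hm, -, hl, C, hC⟩ := h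
  have hvel : ∀ k, D.transfer^[k] v = fun x => deriv (fun t => h k t x) 0 := by
    intro k
    induction k with
    | zero =>
      ext x
      rw [h0]
      exact ((hasDerivAt_pi.1 hv x).deriv).symm
    | succ k ih =>
      rw [Function.iterate_succ_apply', ih]
      exact D.transfer_spec Metric.isOpen_ball (Metric.mem_ball_self hε) Metric.isOpen_ball
        (Metric.mem_ball_self hε) (hm k) (hm (k + 1)) (hl k)
  -- Cauchy's estimate on the circle of radius ε/2. The absolute value is there because C is not
  -- known to be nonnegative when g(P) is empty.
  refine ⟨|C| / (ε / 2), fun k => ?_⟩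
  rw [hvel, pi_norm_le_iff_of_nonneg (by positivity)]
  intro x
  have hsub : Metric.closedBall (0 : ℂ) (ε / 2) ⊆ Metric.ball 0 ε :=
    Metric.closedBall_subset_ball (by linarith)
  refine Complex.norm_deriv_le_of_forall_mem_sphere_norm_le (by positivity)
    ((((hm k).differentiableOn x).mono
      (Metric.closure_ball_subset_closedBall.trans hsub)).diffContOnCl) fun t ht => ?_
  exact (hC k t (hsub (Metric.sphere_subset_closedBall ht)) x).trans (le_abs_self C)

/-- Under the lifting property the transfer operator is power bounded. -/
theorem exists_norm_iterate_transfer_le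
    (hD : D.LiftingProperty ∨ (D.IsReal ∧ D.RealLiftingProperty)) (w : M.gP → ℂ) :
    ∃ C, ∀ k : ℕ, ‖D.transfer^[k] w‖ ≤ C := by
  -- In the real case only real motions are known to have bounded lifts, so real velocities a come
  -- first, realized by ι + ta; a general w is a complex combination of two real vectors.
  have key : ∀ a : M.gP → ℂ, star a = a → ∃ C, ∀ k : ℕ, ‖D.transfer^[k] a‖ ≤ C := by
    intro a ha
    have hd : ∀ t : ℂ, HasDerivAt (fun t : ℂ => M.incl + t • a) a t := fun t => by
      simpa using ((hasDerivAt_id t).smul_const a).const_add M.incl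
    obtain ⟨Λ, h⟩ := exists_hasBoundedLifts hD (γ := fun t => M.incl + t • a) (by simp)
      (Eventually.of_forall fun t => (hd t).differentiableAt)
      fun hR => Eventually.of_forall fun t => by
        rw [star_add, hR.star_incl, star_smul, ha]
        rfl
    exact h.exists_norm_iterate_transfer_le (hd 0)
  obtain ⟨C, hC⟩ := key (w + star w) (by simp [add_comm])
  obtain ⟨C', hC'⟩ := key (Complex.I • (w - star w)) (by
    rw [star_smul, star_sub, star_star, Complex.star_def, Complex.conj_I, neg_smul, ← smul_neg,
      neg_sub])
  refine ⟨2⁻¹ * (C + C'), fun k => ?_⟩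
  have hw : w = (2⁻¹ : ℂ) • (w + star w) + (-(2⁻¹ * Complex.I)) • (Complex.I • (w - star w)) := by
    rw [smul_smul, ← neg_mul_eq_neg_mul, mul_assoc, Complex.I_mul_I, mul_neg_one, neg_neg,
      ← smul_add]
    rw [show w + star w + (w - star w) = (2 : ℂ) • w by rw [two_smul]; abel, smul_smul]
    norm_num
  have hk := hC k
  have hk' := hC' k
  rw [← Module.End.pow_apply] at hk hk' ⊢
  rw [hw, map_add, map_smul, map_smul]
  refine (norm_add_le _ _).trans ?_
  rw [norm_smul, norm_smul]
  simp only [norm_neg, norm_mul, norm_inv, Complex.norm_I, Complex.norm_ofNat, mul_one]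
  linarith

/-- A nontrivial Jordan block at 1 would make the iterates w + k(𝒜w − w) grow linearly, against
power boundedness. -/
theorem transfer_semisimple
    (hD : D.LiftingProperty ∨ (D.IsReal ∧ D.RealLiftingProperty)) (w : M.gP → ℂ)
    (hw : D.transfer (D.transfer w - w) = D.transfer w - w) : D.transfer w = w := by
  obtain ⟨C, hC⟩ := exists_norm_iterate_transfer_le hD w
  have hk : ∀ k : ℕ, D.transfer^[k] w = w + (k : ℂ) • (D.transfer w - w) := by
    intro k
    induction k with
    | zero => simp
    | succ k ih =>
      rw [Function.iterate_succ_apply', ih, map_add, map_smul, hw]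
      push_cast
      rw [add_smul, one_smul]
      abel
  by_contra hne
  have hpos : 0 < ‖D.transfer w - w‖ := norm_pos_iff.2 (sub_ne_zero.2 hne)
  obtain ⟨k, hkl⟩ := exists_nat_gt ((C + ‖w‖) / ‖D.transfer w - w‖)
  rw [div_lt_iff₀ hpos] at hkl
  have h1 : ‖(k : ℂ) • (D.transfer w - w)‖ ≤ C + ‖w‖ := by
    rw [← add_sub_cancel_left w ((k : ℂ) • _), ← hk]
    exact (norm_sub_le _ _).trans (add_le_add (hC k) le_rfl)
  rw [norm_smul, Complex.norm_natCast] at h1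
  linarith

theorem norm_eigenvalue_le_one
    (hD : D.LiftingProperty ∨ (D.IsReal ∧ D.RealLiftingProperty)) {ρ : ℂ}
    (hρ : Module.End.HasEigenvalue D.transfer ρ) : ‖ρ‖ ≤ 1 := by
  obtain ⟨v, hv⟩ := hρ.exists_hasEigenvector
  obtain ⟨C, hC⟩ := exists_norm_iterate_transfer_le hD v
  by_contra hlt
  obtain ⟨n, hn⟩ := pow_unbounded_of_one_lt (C / ‖v‖) (not_le.1 hlt)
  rw [div_lt_iff₀ (norm_pos_iff.2 hv.2)] at hn
  have h1 := hC n
  rw [← Module.End.pow_apply, hv.pow_apply, norm_smul, norm_pow] at h1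
  linarith

/-- A fixed vector of the transfer operator is determined by its coordinates at the `c_{1,j}`. -/
theorem eq_zero_of_critVals_eq_zero (hM : M.OrbitGenerated) {v : M.gP → ℂ}
    (hv : D.transfer v = v) (h0 : M.critVals v = 0) : v = 0 := by
  have hc : ∀ j, v (M.c₁' j) = 0 := fun j => congrFun h0 j
  have hmem : ∀ (x : M.gP) j, M.c₀ j = x → v x = 0 := by
    intro x j hj
    rw [← hv, D.transfer_of_mem v hj, h0]
    simp
  -- Since the coordinates at the c_{1,j} vanish, the equation for a fixed vector reads v(g x) =
  -- g'(x) v(x) off P₀, so zeros propagate along orbits.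
  have hsucc : ∀ x : M.gP, v x = 0 → v (M.gRestr x) = 0 := by
    intro x hx0
    by_cases hx : (x : ℂ) ∈ range M.c₀
    · obtain ⟨j, hj⟩ := hx
      have : M.gRestr x = M.c₁' j := Subtype.ext (congrArg M.g hj.symm)
      rw [this, hc]
    · rw [← hv, D.transfer_of_notMem v hx, h0, map_zero, sub_zero, div_eq_zero_iff] at hx0
      exact hx0.resolve_right (deriv_ne_zero_of_notMem hx)
  ext x
  obtain ⟨j, n, hn⟩ := hM x x.2
  cases n with
  | zero => exact hmem x j hn
  | succ n =>
    have : ∀ n, v ⟨M.g^[n + 1] (M.c₀ j), M.iterate_succ_mem_gP j n⟩ = 0 := by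
      intro n
      induction n with
      | zero => exact hc j
      | succ n ih =>
        have e : (⟨M.g^[n + 1 + 1] (M.c₀ j), M.iterate_succ_mem_gP j (n + 1)⟩ : M.gP)
            = M.gRestr ⟨M.g^[n + 1] (M.c₀ j), M.iterate_succ_mem_gP j n⟩ :=
          Subtype.ext (Function.iterate_succ_apply' M.g (n + 1) (M.c₀ j))
        rw [e]
        exact hsucc _ ih
    rw [← show (⟨M.g^[n + 1] (M.c₀ j), M.iterate_succ_mem_gP j n⟩ : M.gP) = x from Subtype.ext hn]
    exact this n

/-- If `1` is an eigenvalue of the transfer operator, there is a nonconstant holomorphic curve of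
fixed points of the lifting. -/
theorem exists_curve_of_fixed_points (hM : M.OrbitGenerated)
    (hD : D.LiftingProperty ∨ (D.IsReal ∧ D.RealLiftingProperty))
    (h1 : Module.End.HasEigenvalue D.transfer 1) :
    ∃ (γ : ℂ → M.gP → ℂ) (v : M.gP → ℂ), γ 0 = M.incl ∧ (∀ᶠ t in 𝓝 0, DifferentiableAt ℂ γ t) ∧
      HasDerivAt γ v 0 ∧ M.critVals v ≠ 0 ∧ ∀ᶠ t in 𝓝 0, D.liftDefect (γ t, γ t) = 0 := by
  -- In the real case the fixed space is invariant under conjugation: v + v̄ is a real fixed vector,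
  -- and if it vanishes, i v is a nonzero one.
  obtain ⟨v, hv, hv0, hvr⟩ : ∃ v, D.transfer v = v ∧ v ≠ 0 ∧ (D.IsReal → star v = v) := by
    obtain ⟨v, hv⟩ := h1.exists_hasEigenvector
    have hAv : D.transfer v = v := by simpa using hv.apply_eq_smul
    by_cases hR : D.IsReal
    · by_cases hs : v + star v = 0
      · refine ⟨Complex.I • v, by rw [map_smul, hAv], smul_ne_zero Complex.I_ne_zero hv.2,
          fun _ => ?_⟩
        rw [star_smul, eq_neg_of_add_eq_zero_right hs, Complex.star_def, Complex.conj_I, neg_smul,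
          smul_neg, neg_neg]
      · refine ⟨v + star v, ?_, hs, fun _ => by simp [add_comm]⟩
        rw [map_add, hR.transfer_star, hAv]
    · exact ⟨v, hAv, hv.2, fun h => absurd h hR⟩
  obtain ⟨P, hAP, hPA, hPσ⟩ : ∃ P : (M.gP → ℂ) →L[ℂ] (M.gP → ℂ),
      (∀ x, D.transferCLM (P x) = P x) ∧ (∀ x, D.transferCLM x = x → P x = x) ∧
      (D.IsReal → ∀ x, M.conjCLM (P x) = P (M.conjCLM x)) := by
    by_cases hR : D.IsReal
    · obtain ⟨P, h1, h2, h3⟩ := exists_projection_fixed_conj D.transferCLM M.conjCLM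
        (fun x => by simp) (fun x => by simp [hR.transfer_star])
      exact ⟨P, h1, h2, fun _ => h3⟩
    · obtain ⟨P, h1, h2⟩ := exists_projection_fixed D.transferCLM
      exact ⟨P, h1, h2, fun h => absurd h hR⟩
  have hdiag : HasFDerivAt (fun z : M.gP → ℂ => (z, z))
      ((ContinuousLinearMap.id ℂ _).prod (ContinuousLinearMap.id ℂ _)) M.incl :=
    (hasFDerivAt_id _).prodMk (hasFDerivAt_id _)
  obtain ⟨γ, hγ0, hγc, hγv, hγA, hγσ⟩ := exists_curve_of_semisimple
    (Θ := fun z => D.liftDefect (z, z)) (A := D.transferCLM) (P := P) (ι := M.incl) (v := v)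
    (ContDiffAt.comp (f := fun z : M.gP → ℂ => (z, z)) M.incl D.contDiffAt_liftDefect
      (contDiffAt_id.prodMk contDiffAt_id))
    ((HasFDerivAt.comp (f := fun z : M.gP → ℂ => (z, z)) M.incl D.hasFDerivAt_liftDefect
      hdiag).congr_fderiv (by ext; simp))
    D.liftDefect_incl hAP hPA (transfer_semisimple hD) hv
  have hγd : ∀ᶠ t in 𝓝 0, DifferentiableAt ℂ γ t :=
    (hγc.eventually (by simp)).mono fun t ht => ht.differentiableAt one_ne_zero
  refine ⟨γ, v, hγ0, hγd, hγv, fun h => hv0 (eq_zero_of_critVals_eq_zero hM hv h), ?_⟩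
  obtain ⟨Λ, ε, hε, -, h, h0, hm, -, hl, C, hC⟩ := exists_hasBoundedLifts hD hγ0 hγd fun hR =>
    hγσ M.conjCLM hR.star_incl (hvr hR) (hPσ hR) (by
      have hc : ContinuousAt (fun z : M.gP → ℂ => (z, z)) M.incl := by fun_prop
      exact hc.eventually hR.eventually_liftDefect_star)
  refine defect_eq_zero_of_bounded_lifts D.contDiffAt_liftDefect D.hasFDerivAt_liftDefect
    (A := D.transferCLM) (fun α β => by simp) hγd hγA hε h0
    (fun k => differentiableOn_pi.2 (hm k).differentiableOn) (fun k => funext (hm k).base)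
    (fun k => (hl k).eventually_liftDefect_eq_zero) (C := |C|) fun k t ht => ?_
  rw [pi_norm_le_iff_of_nonneg (abs_nonneg C)]
  exact fun x => (hC k t ht x).trans (le_abs_self C)

/-! ### The domain of `ℛ` -/

/-- Both claims go through one induction: the next domain is open because the n-th iterate is
continuous on the previous one. -/
theorem isOpen_and_differentiableOn_iterate_G (D : LocalDeformation M) (j : Fin ν) (n : ℕ) :
    IsOpen {w | w ∈ D.W ∧ ∀ k < n, (D.G w)^[k] (w j) ∈ M.U} ∧
      DifferentiableOn ℂ (fun w => (D.G w)^[n] (w j))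
        {w | w ∈ D.W ∧ ∀ k < n, (D.G w)^[k] (w j) ∈ M.U} := by
  induction n with
  | zero =>
    refine ⟨by simpa using D.isOpen_W, ?_⟩
    simp only [Function.iterate_zero, id_eq]
    fun_prop
  | succ n ih =>
    have e : {w | w ∈ D.W ∧ ∀ k < n + 1, (D.G w)^[k] (w j) ∈ M.U}
        = {w | w ∈ D.W ∧ ∀ k < n, (D.G w)^[k] (w j) ∈ M.U} ∩
          (fun w => (D.G w)^[n] (w j)) ⁻¹' M.U := by
      ext w
      simp only [mem_ofPred_eq, mem_inter_iff, mem_preimage, Nat.forall_lt_succ_right, and_assoc]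
    rw [e]
    refine ⟨ih.2.continuousOn.isOpen_inter_preimage ih.1 M.isOpen_U, ?_⟩
    simp only [Function.iterate_succ_apply']
    exact D.differentiableOn_G.comp
      (differentiableOn_id.prodMk (ih.2.mono inter_subset_left)) fun w hw => ⟨hw.1.1, hw.2⟩

theorem isOpen_domR (D : LocalDeformation M) : IsOpen D.domR := by
  have e : D.domR = D.W ∩ ⋂ j, {w | w ∈ D.W ∧ ∀ k < M.q j - 1, (D.G w)^[k] (w j) ∈ M.U} := by
    ext w
    simp only [domR, mem_ofPred_eq, mem_inter_iff, mem_iInter]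
    exact ⟨fun h => ⟨h.1, fun j => ⟨h.1, h.2 j⟩⟩, fun h => ⟨h.1, fun j => (h.2 j).2⟩⟩
  rw [e]
  exact D.isOpen_W.inter
    (isOpen_iInter_of_finite fun j => (D.isOpen_and_differentiableOn_iterate_G j _).1)

theorem c₁_mem_domR (D : LocalDeformation M) : M.c₁ ∈ D.domR := by
  refine ⟨D.c₁_mem, fun j k hk => ?_⟩
  have h := iterate_G_of_liftDefect_eq_zero D.liftDefect_incl j (n := k)
    fun i hi => M.iterate_notMem_range (hi.trans hk)
  rw [M.critVals_incl] at h
  rw [h]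
  exact mem_U_of_notMem (x := ⟨_, M.iterate_succ_mem_gP j k⟩) (M.iterate_notMem_range hk)

theorem _root_.MarkedMap.l_le_q (M : MarkedMap ν) {j : Fin ν} (h : ¬M.Returns j) :
    M.l j ≤ M.q j := by
  rcases Nat.eq_zero_or_pos (M.q j) with hq | hq
  -- If q = 0, an element l of this set would return c_{0,j} to itself, hence to P₀.
  · have he : {l | 1 ≤ l ∧ M.g^[M.q j] (M.c₀ j) = M.g^[l] (M.c₀ j)} = ∅ := by
      refine eq_empty_of_forall_notMem fun l hl => h ⟨l, hl.1, j, ?_⟩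
      rw [← hl.2, hq]
      rfl
    rw [MarkedMap.l, he, Nat.sInf_empty]
    exact Nat.zero_le _
  · exact Nat.sInf_le ⟨hq, rfl⟩

theorem differentiableOn_R (D : LocalDeformation M) (j : Fin ν) :
    DifferentiableOn ℂ (fun w => D.R w j) D.domR := by
  have hit : ∀ n ≤ M.q j - 1, DifferentiableOn ℂ (fun w => (D.G w)^[n] (w j)) D.domR :=
    fun n hn => (D.isOpen_and_differentiableOn_iterate_G j n).2.mono
      fun w hw => ⟨hw.1, fun k hk => hw.2 j k (hk.trans_le hn)⟩
  by_cases h : M.Returns j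
  · simp only [R, dif_pos h]
    exact (hit _ le_rfl).sub
      (differentiableOn_pi.1 (D.differentiableOn_p.mono fun w hw => hw.1) _)
  · simp only [R, dif_neg h]
    exact (hit _ le_rfl).sub (hit _ (Nat.sub_le_sub_right (M.l_le_q h) 1))

theorem isAnalyticVariety_R (D : LocalDeformation M) :
    IsAnalyticVariety D.domR {w | w ∈ D.domR ∧ D.R w = 0} := by
  refine ⟨fun w hw => hw.1, fun a ha => ⟨D.domR, D.isOpen_domR, ha, Subset.rfl, ν,
    fun j w => D.R w j, D.differentiableOn_R, ?_⟩⟩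
  ext w
  simp only [mem_inter_iff, mem_ofPred_eq, funext_iff, Pi.zero_apply]
  tauto

end LocalDeformation

/-! ### Dimension of the zero set, and conclusion -/

/-- A set that contains a holomorphic curve through `a` with nonzero velocity at `a` has dimension at
least one at `a`. -/
theorem dimAtLeastAt_one_of_curve {n : ℕ} {Z : Set (Fin n → ℂ)} {a v : Fin n → ℂ}
    {c : ℂ → Fin n → ℂ} (h0 : c 0 = a) (hd : ∀ᶠ t in 𝓝 0, DifferentiableAt ℂ c t)
    (hv : HasDerivAt c v 0) (hv0 : v ≠ 0) (hZ : ∀ᶠ t in 𝓝 0, c t ∈ Z) : DimAtLeastAt Z a 1 := by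
  intro N hN
  -- A coordinate with nonzero velocity is locally invertible along the curve; this gives both
  -- injectivity and the immersion property on a small disk.
  obtain ⟨j, hj⟩ := Function.ne_iff.1 hv0
  have hf : AnalyticAt ℂ (fun t => c t j) 0 :=
    Complex.analyticAt_iff_eventually_differentiableAt.2
      (hd.mono fun t ht => differentiableAt_pi.1 ht j)
  have hfv : deriv (fun t => c t j) 0 = v j := (hasDerivAt_pi.1 hv j).deriv
  have hne : deriv (fun t => c t j) 0 ≠ 0 := by rw [hfv]; exact hj
  have hinv := hf.hasStrictDerivAt.eventually_left_inverse hne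
  have hct : Tendsto c (𝓝 0) (𝓝 a) := h0 ▸ hv.continuousAt.tendsto
  obtain ⟨r, hr, hall⟩ := Metric.eventually_nhds_iff_ball.1
    ((((hd.and hZ).and (hct.eventually_mem hN)).and hinv).and
      (hf.deriv.continuousAt.eventually_ne hne))
  have hφ : ∀ s : Fin 1 → ℂ, s 0 ∈ Metric.ball (0 : ℂ) r →
      DifferentiableAt ℂ (fun s : Fin 1 → ℂ => c (s 0)) s := fun s hs =>
    DifferentiableAt.comp (g := c) (f := fun s : Fin 1 → ℂ => s 0) s (hall _ hs).1.1.1.1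
      (by fun_prop)
  refine ⟨1, le_rfl, {s | s 0 ∈ Metric.ball (0 : ℂ) r}, fun s => c (s 0),
    Metric.isOpen_ball.preimage (continuous_apply 0), ⟨0, Metric.mem_ball_self hr⟩,
    fun s hs => (hφ s hs).differentiableWithinAt, ?_, ?_, ?_⟩
  · intro s hs s' hs' hss
    ext i
    rw [Subsingleton.elim i 0, ← (hall _ hs).1.2, ← (hall _ hs').1.2]
    exact congrArg _ (congrFun hss j)
  · intro s hs
    refine (injective_iff_map_eq_zero _).2 fun u hu => ?_
    have h1 := hasFDerivAt_pi'.1 (hφ s hs).hasFDerivAt j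
    have h2 : HasFDerivAt (fun s : Fin 1 → ℂ => c (s 0) j)
        (deriv (fun t => c t j) (s 0) • ContinuousLinearMap.proj (R := ℂ) 0) s :=
      HasDerivAt.comp_hasFDerivAt (f := fun s : Fin 1 → ℂ => s 0) s
        (differentiableAt_pi.1 (hall _ hs).1.1.1.1 j).hasDerivAt
        (ContinuousLinearMap.proj (R := ℂ) (φ := fun _ : Fin 1 => ℂ) 0).hasFDerivAt
    have h3 := congrArg (fun T => T u) (h1.unique h2)
    have h4 : (0 : ℂ) = deriv (fun t => c t j) (s 0) * u 0 := by
      simpa [hu] using h3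
    ext i
    rw [Subsingleton.elim i 0]
    exact (mul_eq_zero.1 h4.symm).resolve_left (hall _ hs).2
  · exact fun s hs => ⟨(hall _ hs).1.1.1.2, (hall _ hs).1.1.2⟩

end

theorem theorem2 {ν : ℕ} (M : MarkedMap ν) (hM : M.OrbitGenerated) (D : LocalDeformation M)
    (hD : D.LiftingProperty ∨ (D.IsReal ∧ D.RealLiftingProperty)) :
    (∀ ρ : ℂ, Module.End.HasEigenvalue D.transfer ρ → ‖ρ‖ ≤ 1 ∧ ρ ≠ 1) ∨
      ∃ W' : Set (Fin ν → ℂ), IsOpen W' ∧ M.c₁ ∈ W' ∧ W' ⊆ D.domR ∧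
        IsAnalyticVariety W' {w | w ∈ W' ∧ D.R w = 0} ∧
        DimAtLeastAt {w | w ∈ W' ∧ D.R w = 0} M.c₁ 1 := by
  by_cases h1 : Module.End.HasEigenvalue D.transfer 1
  · refine Or.inr ⟨D.domR, D.isOpen_domR, D.c₁_mem_domR, Subset.rfl, D.isAnalyticVariety_R, ?_⟩
    obtain ⟨γ, v, hγ0, hγd, hγv, hv, hγ⟩ :=
      LocalDeformation.exists_curve_of_fixed_points hM hD h1
    have hc : HasDerivAt (fun t => M.critVals (γ t)) (M.critVals v) 0 :=
      M.critVals.hasFDerivAt.comp_hasDerivAt (0 : ℂ) hγv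
    have hc0 : M.critVals (γ 0) = M.c₁ := by rw [hγ0, M.critVals_incl]
    refine dimAtLeastAt_one_of_curve hc0
      (hγd.mono fun t ht => M.critVals.differentiableAt.comp t ht) hc hv ?_
    have hdom := hc.continuousAt.eventually_mem
      (hc0 ▸ D.isOpen_domR.mem_nhds D.c₁_mem_domR : D.domR ∈ 𝓝 (M.critVals (γ 0)))
    filter_upwards [hγ, hdom] with t ht ht'
    exact ⟨ht', LocalDeformation.R_eq_zero_of_liftDefect_eq_zero ht⟩
  · exact Or.inl fun ρ hρ =>
      ⟨LocalDeformation.norm_eigenvalue_le_one hD hρ, fun h => h1 (h ▸ hρ)⟩
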